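/- Let $D=(0,1)$, $1<\alpha<2$, and let $(\cdot,\cdot)$ be the inner product of the real space $L^2(D)$. For $s\ge 0$ let $\widetilde H^{s}(D)$ be the space of real-valued $u\in L^2(D)$ whose extension by zero $\tilde u$ belongs to $H^s(\mathbb R)$, with the norm $\|\tilde u\|_{H^s(\mathbb R)}$. Put $V=\widetilde H^{\alpha/2}(D)$ and let $V^*$ be its dual space. For $\gamma>0$ let $$({}_0I_x^\gamma f)(x)=\frac1{\Gamma(\gamma)}\int_0^x (x-t)^{\gamma-1}f(t)\,dt,\qquad ({}_xI_1^\gamma f)(x)=\frac1{\Gamma(\gamma)}\int_x^1 (t-x)^{\gamma-1}f(t)\,dt,$$ and for $0<\beta<1$ let ${}_0D_x^\beta u=\frac{d}{dx}\,{}_0I_x^{1-\beta}u$ and ${}_xD_1^\beta u=-\frac{d}{dx}\,{}_xI_1^{1-\beta}u$ be the Riemann–Liouville derivatives, where $\frac{d}{dx}$ is the weak derivative on $D$. Let $q\in L^\infty(D)$ be real-valued with ${}_0I_x^\alpha\big(q\,(x^{\alpha-1}-x^2)\big)(1)\ne -1$, and put $$c_0=\frac{1}{1+{}_0I_x^\alpha\big(q\,(x^{\alpha-1}-x^2)\big)(1)},\quad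 c_1(x)=-\frac{2}{\Gamma(3-\alpha)}x^{2-\alpha},\quad Q(x)=c_0c_1(x)-c_0\,q(x)\,(x^{\alpha-1}-x^2).$$ For $u,v\in V$ define $$A(u,v)=-\big({}_0D_x^{\alpha/2}u,\ {}_xD_1^{\alpha/2}v\big),\quad b(u,v)=(qu,v)+{}_0I_x^\alpha(qu)(1)\,(Q,v),\quad a_r(u,v)=A(u,v)+b(u,v).$$ **Theorem 3.1.** Assume that (a) if $u\in V$ satisfies $a_r(u,v)=0$ for all $v\in V$, then $u=0$; (a$^*$) if $v\in V$ satisfies $a_r(u,v)=0$ for all $u\in V$, then $v=0$. Then for every $F\in V^*$ there exists a unique $u\in V$ such that $a_r(u,v)=\langle F,v\rangle$ for all $v\in V$. -/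

import Mathlib

namespace FracBVP

open MeasureTheory Set
open scoped ENNReal SchwartzMap ContDiff

noncomputable section

/-! ### The spaces `H̃^s(0,1)` -/

/-- Lebesgue measure on the unit interval `D = (0,1)`. -/
abbrev μD : Measure ℝ := volume.restrict (Ioo (0 : ℝ) 1)

theorem memLp_zeroExt (u : Lp ℝ 2 μD) :
    MemLp (fun x : ℝ => (((Ioo (0 : ℝ) 1).indicator (u : ℝ → ℝ) x : ℝ) : ℂ)) 2 volume :=
  ((memLp_indicator_iff_restrict measurableSet_Ioo).2 (Lp.memLp u)).ofReal

/-- The extension `ũ` of `u ∈ L²(0,1)` by zero to the real line, as a (complex-valued) element of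
`L²(ℝ)`. -/
def zeroExt : Lp ℝ 2 μD →ₗ[ℝ] Lp ℂ 2 (volume : Measure ℝ) where
  toFun u := (memLp_zeroExt u).toLp _
  map_add' u v := by
    rw [← MemLp.toLp_add]
    apply MemLp.toLp_congr
    have h := (ae_restrict_iff' measurableSet_Ioo).1 (Lp.coeFn_add u v)
    filter_upwards [h] with x hx
    by_cases hD : x ∈ Ioo (0 : ℝ) 1
    · have h2 := hx hD
      rw [Pi.add_apply] at h2
      rw [Pi.add_apply, indicator_of_mem hD, indicator_of_mem hD, indicator_of_mem hD, h2,
        Complex.ofReal_add]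
    · simp [hD]
  map_smul' c u := by
    rw [RingHom.id_apply, ← MemLp.toLp_const_smul]
    apply MemLp.toLp_congr
    have h := (ae_restrict_iff' measurableSet_Ioo).1 (Lp.coeFn_smul c u)
    filter_upwards [h] with x hx
    by_cases hD : x ∈ Ioo (0 : ℝ) 1
    · have h2 := hx hD
      rw [Pi.smul_apply] at h2
      rw [Pi.smul_apply, indicator_of_mem hD, indicator_of_mem hD, h2, smul_eq_mul,
        Complex.ofReal_mul, Complex.real_smul]
    · simp [hD]

theorem zeroExt_injective : Function.Injective zeroExt := by
  rw [injective_iff_map_eq_zero]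
  intro u hu
  have h1 : zeroExt u =ᵐ[volume]
      fun x : ℝ => (((Ioo (0 : ℝ) 1).indicator (u : ℝ → ℝ) x : ℝ) : ℂ) :=
    MemLp.coeFn_toLp (memLp_zeroExt u)
  rw [hu] at h1
  rw [Lp.eq_zero_iff_ae_eq_zero]
  refine (ae_restrict_iff' measurableSet_Ioo).2 ?_
  filter_upwards [h1, Lp.coeFn_zero ℂ 2 (volume : Measure ℝ)] with x hx h0 hD
  rw [h0] at hx
  simpa [hD] using hx.symm

/-- The distribution on `ℝ` given by the zero extension of `u`. -/
def zeroExtDistr (u : Lp ℝ 2 μD) : 𝓢'(ℝ, ℂ) :=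
  Lp.toTemperedDistributionCLM ℂ volume 2 (zeroExt u)

theorem zeroExtDistr_add (u v : Lp ℝ 2 μD) :
    zeroExtDistr (u + v) = zeroExtDistr u + zeroExtDistr v := by
  rw [zeroExtDistr, map_add, map_add, zeroExtDistr, zeroExtDistr]

theorem zeroExtDistr_smul (c : ℝ) (u : Lp ℝ 2 μD) :
    zeroExtDistr (c • u) = (c : ℂ) • zeroExtDistr u := by
  have : c • zeroExt u = (c : ℂ) • zeroExt u := by
    ext1
    filter_upwards [Lp.coeFn_smul c (zeroExt u), Lp.coeFn_smul (c : ℂ) (zeroExt u)] with x h1 h2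
    rw [h1, h2]
    simp
  rw [zeroExtDistr, map_smul, this, map_smul, zeroExtDistr]

theorem toTemperedDistributionCLM_injective :
    Function.Injective (Lp.toTemperedDistributionCLM ℂ (volume : Measure ℝ) 2) :=
  LinearMap.ker_eq_bot.1 Lp.ker_toTemperedDistributionCLM_eq_bot

/-- `H̃^s(0,1)` for `s ≥ 0`, as a subspace of `L²(0,1)`: the functions whose extension by zero
belongs to `H^s(ℝ)`. (That the function itself lies in `H^s(0,1)`, the space of restrictions
of functions in `H^s(ℝ)`, is then automatic.) -/
def hTildeSubmodule (s : ℝ) : Submodule ℝ (Lp ℝ 2 μD) where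
  carrier := {u | TemperedDistribution.MemSobolev s 2 (zeroExtDistr u)}
  add_mem' {u v} hu hv := by
    change TemperedDistribution.MemSobolev s 2 (zeroExtDistr (u + v))
    rw [zeroExtDistr_add]
    exact TemperedDistribution.MemSobolev.add hu hv
  zero_mem' := by
    change TemperedDistribution.MemSobolev s 2 (zeroExtDistr 0)
    rw [zeroExtDistr, map_zero, map_zero]
    exact TemperedDistribution.memSobolev_fun_zero ℝ ℂ s 2
  smul_mem' c u hu := by
    change TemperedDistribution.MemSobolev s 2 (zeroExtDistr (c • u))
    rw [zeroExtDistr_smul]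
    exact TemperedDistribution.MemSobolev.smul _ hu

/-- The space `H̃^s(0,1)`. It is a type of its own because it carries the norm of `H^s`, not the one
of `L²`. -/
def HTilde (s : ℝ) : Type := hTildeSubmodule s

namespace HTilde

instance (s : ℝ) : AddCommGroup (HTilde s) :=
  inferInstanceAs (AddCommGroup (hTildeSubmodule s))

instance (s : ℝ) : Module ℝ (HTilde s) :=
  inferInstanceAs (Module ℝ (hTildeSubmodule s))

/-- The inclusion of `H̃^s(0,1)` into `L²(0,1)`. -/
def toL2 (s : ℝ) : HTilde s →ₗ[ℝ] Lp ℝ 2 μD := (hTildeSubmodule s).subtype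

theorem toL2_injective (s : ℝ) : Function.Injective (toL2 s) := Subtype.val_injective

/-- A function representing the class `u`. -/
instance (s : ℝ) : CoeFun (HTilde s) (fun _ => ℝ → ℝ) := ⟨fun u => (toL2 s u : ℝ → ℝ)⟩

theorem memSobolev {s : ℝ} (u : HTilde s) :
    TemperedDistribution.MemSobolev s 2 (zeroExtDistr (toL2 s u)) := u.2

/-- The `L²(ℝ)` function `𝓕⁻¹ ((1 + |ξ|²)^(s/2) 𝓕 ũ)`, where `ũ` is the extension of `u` by zero. -/
def besselFun {s : ℝ} (u : HTilde s) : Lp ℂ 2 (volume : Measure ℝ) := (memSobolev u).choose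

theorem besselFun_spec {s : ℝ} (u : HTilde s) :
    TemperedDistribution.besselPotential ℝ ℂ s (zeroExtDistr (toL2 s u)) =
      Lp.toTemperedDistributionCLM ℂ volume 2 (besselFun u) :=
  (memSobolev u).choose_spec

/-- `besselFun` as a linear map. -/
def bessel (s : ℝ) : HTilde s →ₗ[ℝ] Lp ℂ 2 (volume : Measure ℝ) where
  toFun u := besselFun u
  map_add' u v := by
    apply toTemperedDistributionCLM_injective
    rw [map_add, ← besselFun_spec, ← besselFun_spec, ← besselFun_spec, map_add (toL2 s),
      zeroExtDistr_add, map_add]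
  map_smul' c u := by
    apply toTemperedDistributionCLM_injective
    have : c • besselFun u = (c : ℂ) • besselFun u := by
      ext1
      filter_upwards [Lp.coeFn_smul c (besselFun u),
        Lp.coeFn_smul (c : ℂ) (besselFun u)] with x h1 h2
      rw [h1, h2]
      simp
    rw [RingHom.id_apply, this, map_smul, ← besselFun_spec, ← besselFun_spec,
      map_smul (toL2 s), zeroExtDistr_smul, map_smul]

theorem bessel_spec {s : ℝ} (u : HTilde s) :
    TemperedDistribution.besselPotential ℝ ℂ s (zeroExtDistr (toL2 s u)) =
      Lp.toTemperedDistributionCLM ℂ volume 2 (bessel s u) :=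
  besselFun_spec u

theorem bessel_injective (s : ℝ) : Function.Injective (bessel s) := by
  intro u v h
  have hu := bessel_spec u
  rw [h, ← bessel_spec v] at hu
  have h' := (TemperedDistribution.besselPotential_neg_apply_eq_iff s _ _).2 hu
  rw [(TemperedDistribution.besselPotential_neg_apply_eq_iff s _ _).2 rfl] at h'
  exact toL2_injective s (zeroExt_injective (toTemperedDistributionCLM_injective h'.symm))

/-- The norm of `H̃^s(0,1)` is `‖u‖ = ‖ũ‖_{H^s(ℝ)} = ‖(1 + |ξ|²)^(s/2) 𝓕 ũ‖_{L²(ℝ)}`. -/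
instance (s : ℝ) : NormedAddCommGroup (HTilde s) :=
  NormedAddCommGroup.induced (HTilde s) (Lp ℂ 2 (volume : Measure ℝ)) (bessel s)
    (bessel_injective s)

instance (s : ℝ) : NormedSpace ℝ (HTilde s) :=
  NormedSpace.induced ℝ (HTilde s) (Lp ℂ 2 (volume : Measure ℝ)) (bessel s)

theorem norm_eq {s : ℝ} (u : HTilde s) : ‖u‖ = ‖bessel s u‖ := rfl

end HTilde

/-! ### Fractional integrals and derivatives -/

/-- The left-sided Riemann–Liouville integral
`(₀I_x^γ f)(x) = Γ(γ)⁻¹ ∫_0^x (x - t)^(γ - 1) f(t) dt`. -/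
def leftInt (γ : ℝ) (f : ℝ → ℝ) (x : ℝ) : ℝ :=
  1 / Real.Gamma γ * ∫ t in (0 : ℝ)..x, (x - t) ^ (γ - 1) * f t

/-- The right-sided Riemann–Liouville integral
`(ₓI_1^γ f)(x) = Γ(γ)⁻¹ ∫_x^1 (t - x)^(γ - 1) f(t) dt`. -/
def rightInt (γ : ℝ) (f : ℝ → ℝ) (x : ℝ) : ℝ :=
  1 / Real.Gamma γ * ∫ t in x..(1 : ℝ), (t - x) ^ (γ - 1) * f t

/-- `g` is the weak derivative of `w` on `(0,1)`. -/
structure HasWeakDeriv (w g : ℝ → ℝ) : Prop where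
  locallyIntegrable : LocallyIntegrableOn w (Ioo 0 1)
  locallyIntegrable_deriv : LocallyIntegrableOn g (Ioo 0 1)
  integral_eq : ∀ φ : ℝ → ℝ, ContDiff ℝ ∞ φ → HasCompactSupport φ → tsupport φ ⊆ Ioo 0 1 →
    ∫ x in Ioo (0 : ℝ) 1, w x * deriv φ x = -∫ x in Ioo (0 : ℝ) 1, g x * φ x

open Classical in
/-- The weak derivative of `w` on `(0,1)` (unique up to null sets), and `0` if there is none. -/
def weakDeriv (w : ℝ → ℝ) : ℝ → ℝ :=
  if h : ∃ g, HasWeakDeriv w g then h.choose else 0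

/-- The left-sided Riemann–Liouville derivative `d/dx (₀I_x^(1-β) u)` of order `β ∈ (0,1)`. -/
def leftDeriv (β : ℝ) (u : ℝ → ℝ) : ℝ → ℝ := weakDeriv (leftInt (1 - β) u)

/-- The right-sided Riemann–Liouville derivative `-d/dx (ₓI_1^(1-β) u)` of order `β ∈ (0,1)`. -/
def rightDeriv (β : ℝ) (u : ℝ → ℝ) : ℝ → ℝ := -weakDeriv (rightInt (1 - β) u)

/-! ### The bilinear forms -/

/-- `A(u,v) = -(₀D_x^(α/2) u, ₓD_1^(α/2) v)`, with the inner product of `L²(0,1)`. -/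
def formA (α : ℝ) (u v : HTilde (α / 2)) : ℝ :=
  -∫ x in Ioo (0 : ℝ) 1, leftDeriv (α / 2) u x * rightDeriv (α / 2) v x

/-- The function `x^(α-1) - x²`. -/
def singFun (α : ℝ) (x : ℝ) : ℝ := x ^ (α - 1) - x ^ 2

/-- `c₀ = 1 / (1 + ₀I_x^α (q (x^(α-1) - x²)) (1))`. -/
def c₀ (α : ℝ) (q : ℝ → ℝ) : ℝ :=
  1 / (1 + leftInt α (fun t => q t * singFun α t) 1)

/-- `c₁(x) = -2 / Γ(3 - α) x^(2-α)`. -/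
def c₁ (α : ℝ) (x : ℝ) : ℝ := -(2 / Real.Gamma (3 - α)) * x ^ (2 - α)

/-- `Q(x) = c₀ c₁(x) - c₀ q(x) (x^(α-1) - x²)`. -/
def Q (α : ℝ) (q : ℝ → ℝ) (x : ℝ) : ℝ :=
  c₀ α q * c₁ α x - c₀ α q * q x * singFun α x

/-- `b(u,v) = (q u, v) + ₀I_x^α (q u) (1) (Q, v)`. -/
def formB (α : ℝ) (q : ℝ → ℝ) (u v : HTilde (α / 2)) : ℝ :=
  (∫ x in Ioo (0 : ℝ) 1, q x * u x * v x) +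
    leftInt α (fun t => q t * u t) 1 * ∫ x in Ioo (0 : ℝ) 1, Q α q x * v x

/-- `a_r(u,v) = A(u,v) + b(u,v)`. -/
def formAr (α : ℝ) (q : ℝ → ℝ) (u v : HTilde (α / 2)) : ℝ :=
  formA α u v + formB α q u v

/-- The uniqueness assumption on `a_r`, for the problem and for its adjoint. -/
structure UniquenessAssumption (α : ℝ) (q : ℝ → ℝ) : Prop where
  a : ∀ u : HTilde (α / 2), (∀ v : HTilde (α / 2), formAr α q u v = 0) → u = 0
  a_star : ∀ v : HTilde (α / 2), (∀ u : HTilde (α / 2), formAr α q u v = 0) → v = 0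

end

end FracBVP

/-!
The form `a_r` is a compact perturbation of a coercive form on `V = H̃^(α/2)(0,1)`, so the Fredholm
alternative turns uniqueness into unique solvability (`existsUnique_of_garding`).

*Coercivity.* Put `β = α/2`. On the Fourier side the left- and right-sided derivatives of order `β`
are multiplication by `(2πiξ)^β` and `(-2πiξ)^β`. The left-sided derivative of the zero extension
of `u` vanishes on the negative axis and the right-sided one of `v` beyond `1`, so the integral over
`(0,1)` that defines `A(u,v)` equals the integral over `ℝ`
(`integral_leftDeriv_mul_rightDeriv`), and Plancherel's theorem gives
`A(u,u) = -cos(πα/2) ∫ |2πξ|^α |𝓕 ũ|²`. Since `1 < α < 2` the cosine is negative, and `A` satisfies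
Gårding's inequality (`garding_bilinA`).

*Identification of the derivatives.* The Riemann–Liouville kernel is not integrable on the line, so
it is damped by `e^(-εt)`. The damped kernel has Fourier transform `(ε + 2πiξ)^(β - 1)`, by analytic
continuation of Euler's integral (`integral_rpow_mul_cexp_neg_mul_Ioi`). Pairing with the derivative
of a test function makes both sides converge as `ε → 0`, which shows that the weak derivative of the
fractional integral is `𝓕⁻¹ ((2πiξ)^β 𝓕 ũ)` (`hasWeakDeriv_of_eq_fracInt`). The two sides are
treated at once, with a sign `σ = ±1`.

*Compactness.* The form `b` is bounded on `L²(0,1)` (`bilinB`), and `V` embeds compactly into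
`L²(0,1)` (`HTilde.isCompactOperator_toL2L`): for `u` in a bounded set the transforms `𝓕 ũ` are
uniformly Lipschitz, and the `H^β` norm controls the high frequencies.
-/

namespace FracBVP

open MeasureTheory Set
open scoped ENNReal SchwartzMap ContDiff
open FourierTransform Filter Topology LineDeriv

/-! ### Fredholm alternative for forms satisfying a Gårding inequality -/

noncomputable section

/-- The inner product of a real Hilbert space, as a bilinear (rather than sesquilinear) map. -/
def innerBilin (E : Type*) [NormedAddCommGroup E] [InnerProductSpace ℝ E] : E →L[ℝ] E →L[ℝ] ℝ :=
  innerSL ℝ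

@[simp] theorem innerBilin_apply {E : Type*} [NormedAddCommGroup E] [InnerProductSpace ℝ E]
    (x y : E) : innerBilin E x y = inner ℝ x y := innerSL_apply_apply ℝ x y

section Garding

open InnerProductSpace

variable {H L : Type*} [NormedAddCommGroup H] [InnerProductSpace ℝ H] [CompleteSpace H]
  [NormedAddCommGroup L] [InnerProductSpace ℝ L] [CompleteSpace L]

theorem surjective_id_add_of_isCompactOperator {T : H →L[ℝ] H} (hT : IsCompactOperator T)
    (hinj : ∀ u, u + T u = 0 → u = 0) (f : H) : ∃ u, u + T u = f := by
  rcases hT.hasEigenvalue_or_mem_resolventSet (μ := (-1 : ℝ)) (by norm_num) with h | h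
  · obtain ⟨u, hu⟩ := h.exists_hasEigenvector
    refine absurd (hinj u ?_) hu.2
    have := hu.apply_eq_smul
    simp only [ContinuousLinearMap.coe_coe] at this
    rw [this]; simp
  · rw [spectrum.mem_resolventSet_iff, ContinuousLinearMap.isUnit_iff_bijective] at h
    obtain ⟨u, hu⟩ := h.2 (-f)
    refine ⟨u, ?_⟩
    simp [Algebra.algebraMap_eq_smul_one] at hu
    rw [← neg_neg f, ← hu]; abel

/-- A bounded form `A` that is coercive up to a multiple of `‖J u‖²` with `J` compact, plus a form
that factors through `J`, represents every functional uniquely as soon as it is nondegenerate in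
its first argument. -/
theorem existsUnique_of_garding (J : H →L[ℝ] L) (hJ : IsCompactOperator J)
    (A : H →L[ℝ] H →L[ℝ] ℝ) (B : L →L[ℝ] L →L[ℝ] ℝ) {c C : ℝ} (hc : 0 < c)
    (hA : ∀ u, c * ‖u‖ ^ 2 ≤ A u u + C * ‖J u‖ ^ 2)
    (hinj : ∀ u, (∀ v, A u v + B (J u) (J v) = 0) → u = 0) (F : StrongDual ℝ H) :
    ∃! u, ∀ v, A u v + B (J u) (J v) = F v := by
  -- `A'` is coercive; what is subtracted in `B'` to compensate still factors through `J`.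
  let A' : H →L[ℝ] H →L[ℝ] ℝ := A + C • (innerBilin L).bilinearComp J J
  have hA' : IsCoercive A' := by
    refine ⟨c, hc, fun u => ?_⟩
    have : A' u u = A u u + C * ‖J u‖ ^ 2 := by
      simp [A']
    rw [this]
    linarith [hA u]
  let B' : L →L[ℝ] L →L[ℝ] ℝ := B - C • innerBilin L
  let S : L →L[ℝ] L := continuousLinearMapOfBilin B'
  let e := hA'.continuousLinearEquivOfBilin
  -- With `e`, `K` the operators of `A'` and `B'`, the equation is `e u + K u = F`.
  let K : H →L[ℝ] H := (ContinuousLinearMap.adjoint J) ∘L S ∘L J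
  have hK : IsCompactOperator K :=
    (hJ.clm_comp S).clm_comp (ContinuousLinearMap.adjoint J)
  let T : H →L[ℝ] H := (e.symm : H →L[ℝ] H) ∘L K
  have hT : IsCompactOperator T := hK.clm_comp (e.symm : H →L[ℝ] H)
  have key : ∀ u v, inner ℝ (e (u + T u)) v = A u v + B (J u) (J v) := by
    intro u v
    have h1 : e (T u) = K u := e.apply_symm_apply _
    have h2 : inner ℝ (K u) v = B' (J u) (J v) := by
      simp only [K, ContinuousLinearMap.comp_apply, ContinuousLinearMap.adjoint_inner_left, S]
      exact continuousLinearMapOfBilin_apply B' _ _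
    rw [map_add, inner_add_left, h1, h2, IsCoercive.continuousLinearEquivOfBilin_apply]
    simp [A', B']
  have hu : ∀ u, u + T u = 0 → u = 0 := by
    intro u h
    refine hinj u fun v => ?_
    rw [← key, h, map_zero, inner_zero_left]
  obtain ⟨u, hu'⟩ := surjective_id_add_of_isCompactOperator hT hu
    (e.symm ((toDual ℝ H).symm F))
  refine ⟨u, fun v => ?_, fun w hw => ?_⟩
  · rw [← key, hu', e.apply_symm_apply, toDual_symm_apply]
  · have hsol : ∀ v, A u v + B (J u) (J v) = F v := fun v => by
      rw [← key, hu', e.apply_symm_apply, toDual_symm_apply]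
    refine sub_eq_zero.1 (hinj _ fun v => ?_)
    simp only [map_sub, sub_apply]
    linarith [hw v, hsol v]

/-- An operator that is small in norm on suitable subspaces of finite codimension is a norm limit of
operators of finite rank, hence compact. -/
theorem isCompactOperator_of_forall_small (J : H →L[ℝ] L)
    (h : ∀ ε > 0, ∃ (G : Type) (_ : NormedAddCommGroup G) (_ : NormedSpace ℝ G)
      (_ : FiniteDimensional ℝ G) (ℓ : H →L[ℝ] G), ∀ u, ℓ u = 0 → ‖J u‖ ≤ ε * ‖u‖) :
    IsCompactOperator J := by
  have hcl : IsClosed {f : H →L[ℝ] L | IsCompactOperator f} := isClosed_setOfPred_isCompactOperator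
  suffices J ∈ closure {f : H →L[ℝ] L | IsCompactOperator f} by rwa [hcl.closure_eq] at this
  rw [Metric.mem_closure_iff]
  intro ε hε
  obtain ⟨G, _, _, _, ℓ, hℓ⟩ := h (ε / 2) (half_pos hε)
  let N : Submodule ℝ H := ℓ.ker
  have hN : IsClosed (N : Set H) := ℓ.isClosed_ker
  have : CompleteSpace N := hN.completeSpace_coe
  have hfin : FiniteDimensional ℝ Nᗮ := by
    refine FiniteDimensional.of_injective ((ℓ : H →ₗ[ℝ] G).domRestrict Nᗮ) ?_
    rw [injective_iff_map_eq_zero]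
    intro x hx
    have h1 : (x : H) ∈ N := hx
    exact Subtype.ext (inner_self_eq_zero.1 (x.2 _ h1))
  let P : H →L[ℝ] H := Nᗮ.starProjection
  refine ⟨J ∘L P, ?_, ?_⟩
  · have : IsCompactOperator (Nᗮ.orthogonalProjectionOnto : H →L[ℝ] Nᗮ) := by
      exact isCompactOperator_of_locallyCompactSpace_dom _
    exact this.clm_comp (J ∘L Nᗮ.subtypeL)
  · rw [dist_eq_norm]
    refine lt_of_le_of_lt (ContinuousLinearMap.opNorm_le_bound _ (half_pos hε).le fun u => ?_)
      (half_lt_self hε)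
    have h1 : (J - J ∘L P) u = J (u - P u) := by simp
    have h2 : u - P u = N.starProjection u := by
      have := Submodule.starProjection_add_starProjection_orthogonal (K := N) u
      rw [sub_eq_iff_eq_add]; exact this.symm
    rw [h1, h2]
    refine (hℓ _ ?_).trans ?_
    · exact (N.starProjection_apply_mem u : N.starProjection u ∈ N)
    · gcongr
      exact N.norm_starProjection_apply_le u

end Garding

/-! ### The spaces `H̃^s(0,1)` on the Fourier side -/

namespace HTilde

variable {s : ℝ}

instance : InnerProductSpace ℝ (HTilde s) where
  inner u v := inner ℝ (bessel s u) (bessel s v)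
  norm_sq_eq_re_inner u := by
    rw [norm_eq]
    exact (real_inner_self_eq_norm_sq _).symm
  conj_inner_symm u v := by
    simp [real_inner_comm]
  add_left u v w := by
    rw [map_add]
    exact inner_add_left _ _ _
  smul_left u v c := by
    rw [map_smul]
    exact inner_smul_left _ _ _

/-- The isometry `u ↦ (1 + |ξ|²)^(s/2) 𝓕 ũ` of `H̃^s(0,1)` into `L²(ℝ)`. -/
def fourierSide (s : ℝ) : HTilde s →ₗᵢ[ℝ] Lp ℂ 2 (volume : Measure ℝ) where
  toFun u := 𝓕 (bessel s u)
  map_add' u v := by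
    rw [map_add]
    exact (Lp.fourierTransformₗᵢ ℝ ℂ).map_add _ _
  map_smul' c u := by
    rw [map_smul]
    exact ((Lp.fourierTransformₗᵢ ℝ ℂ).toLinearIsometry.toLinearMap.restrictScalars ℝ).map_smul c _
  norm_map' u := by
    rw [norm_eq]
    exact Lp.norm_fourier_eq _

end HTilde

theorem zeroExt_ae_eq (u : Lp ℝ 2 μD) :
    zeroExt u =ᵐ[volume] fun x : ℝ => (((Ioo (0 : ℝ) 1).indicator (u : ℝ → ℝ) x : ℝ) : ℂ) :=
  MemLp.coeFn_toLp (memLp_zeroExt u)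

theorem norm_zeroExt (u : Lp ℝ 2 μD) : ‖zeroExt u‖ = ‖u‖ := by
  rw [Lp.norm_def, Lp.norm_def, eLpNorm_congr_ae (zeroExt_ae_eq u)]
  congr 1
  rw [← eLpNorm_indicator_eq_eLpNorm_restrict measurableSet_Ioo]
  refine eLpNorm_congr_norm_ae (.of_forall fun x => ?_)
  simp

theorem ae_eq_of_toTemperedDistribution_smulLeft {w : ℝ → ℂ} (hw : w.HasTemperateGrowth)
    {f g : Lp ℂ 2 (volume : Measure ℝ)}
    (h : TemperedDistribution.smulLeftCLM ℂ w (Lp.toTemperedDistributionCLM ℂ volume 2 f) =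
      Lp.toTemperedDistributionCLM ℂ volume 2 g) :
    (g : ℝ → ℂ) =ᵐ[volume] fun x => w x * f x := by
  have hf : LocallyIntegrable (fun x => w x * f x) volume := by
    have := (Lp.memLp f).locallyIntegrable (by norm_num)
    have hc : Continuous w := hw.1.continuous
    exact locallyIntegrableOn_univ.1 (((locallyIntegrableOn_univ.2 this)).continuousOn_mul
      hc.continuousOn isOpen_univ.isLocallyClosed)
  refine ae_eq_of_integral_contDiff_smul_eq ((Lp.memLp g).locallyIntegrable (by norm_num)) hf ?_
  intro φ hφ hφc
  have hg₁ : HasCompactSupport (Complex.ofRealCLM ∘ φ) := hφc.comp_left rfl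
  have hg₂ : ContDiff ℝ ∞ (Complex.ofRealCLM ∘ φ) := by fun_prop
  have := congrArg (fun T => T (hg₁.toSchwartzMap hg₂)) h
  simp only [TemperedDistribution.smulLeftCLM_apply_apply, Lp.toTemperedDistributionCLM_apply,
    Lp.toTemperedDistribution_apply] at this
  refine Eq.trans ?_ (this.symm.trans ?_) <;>
  refine integral_congr_ae (.of_forall fun x => ?_)
  · simp
  · simp only [SchwartzMap.smulLeftCLM_apply_apply hw]
    simp
    ring

theorem hasTemperateGrowth_besselWeight (s : ℝ) :
    (fun x : ℝ => (((1 + ‖x‖ ^ 2) ^ (s / 2) : ℝ) : ℂ)).HasTemperateGrowth := by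
  fun_prop

namespace HTilde
variable {s : ℝ}

theorem fourierSide_ae_eq_fourier_zeroExt (u : HTilde s) :
    fourierSide s u =ᵐ[volume] fun ξ =>
      (((1 + ‖ξ‖ ^ 2) ^ (s / 2) : ℝ) : ℂ) * (𝓕 (zeroExt (toL2 s u)) : Lp ℂ 2 volume) ξ := by
  refine ae_eq_of_toTemperedDistribution_smulLeft (hasTemperateGrowth_besselWeight s) ?_
  have h := congrArg 𝓕 (bessel_spec u)
  rw [TemperedDistribution.fourier_besselPotential_eq_smulLeftCLM_fourier_apply, zeroExtDistr,
    Lp.toTemperedDistributionCLM_apply, Lp.toTemperedDistributionCLM_apply,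
    Lp.fourier_toTemperedDistribution_eq, Lp.fourier_toTemperedDistribution_eq] at h
  exact h

theorem norm_toL2_le (hs : 0 ≤ s) (u : HTilde s) : ‖toL2 s u‖ ≤ ‖u‖ := by
  rw [← (fourierSide s).norm_map, ← norm_zeroExt, ← Lp.norm_fourier_eq]
  refine Lp.norm_le_norm_of_ae_le ?_
  filter_upwards [fourierSide_ae_eq_fourier_zeroExt u] with ξ hξ
  rw [hξ, norm_mul]
  refine le_mul_of_one_le_left (norm_nonneg _) ?_
  rw [Complex.norm_real, Real.norm_of_nonneg (by positivity)]
  exact Real.one_le_rpow (by nlinarith [norm_nonneg ξ]) (by positivity)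

/-- The inclusion of `H̃^s(0,1)` into `L²(0,1)` as a continuous linear map. -/
def toL2L (hs : 0 ≤ s) : HTilde s →L[ℝ] Lp ℝ 2 μD :=
  (toL2 s).mkContinuous 1 fun u => by simpa using norm_toL2_le hs u

@[simp] theorem toL2L_apply (hs : 0 ≤ s) (u : HTilde s) : toL2L hs u = toL2 s u := rfl

/-- If `u n` is Cauchy in `H̃^s`, then both `u n` and its Bessel potentials converge in `L²`; the
limits match because the Bessel potential is continuous on tempered distributions. -/
theorem completeSpace (hs : 0 ≤ s) : CompleteSpace (HTilde s) := by
  refine Metric.complete_of_cauchySeq_tendsto fun u hu => ?_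
  have hb : CauchySeq fun n => bessel s (u n) := by
    rw [Metric.cauchySeq_iff'] at hu ⊢
    intro ε hε
    obtain ⟨N, hN⟩ := hu ε hε
    refine ⟨N, fun n hn => ?_⟩
    rw [dist_eq_norm, ← map_sub, ← norm_eq, ← dist_eq_norm]
    exact hN n hn
  obtain ⟨f, hf⟩ := cauchySeq_tendsto_of_complete hb
  obtain ⟨w, hw⟩ := cauchySeq_tendsto_of_complete
    ((toL2L hs).uniformContinuous.comp_cauchySeq hu)
  have hz : Tendsto (fun n => zeroExt (toL2 s (u n))) atTop (𝓝 (zeroExt w)) :=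
    (zeroExt.mkContinuous 1 fun v => by
      rw [one_mul, norm_zeroExt]).continuous.continuousAt.tendsto.comp hw
  have h1 : TemperedDistribution.besselPotential ℝ ℂ s (zeroExtDistr w) =
      Lp.toTemperedDistributionCLM ℂ volume 2 f := by
    refine tendsto_nhds_unique
      (f := fun n => TemperedDistribution.besselPotential ℝ ℂ s (zeroExtDistr (toL2 s (u n))))
      (l := atTop) ?_ ?_
    · exact ((TemperedDistribution.besselPotential ℝ ℂ s).continuous.tendsto _).comp
        (((Lp.toTemperedDistributionCLM ℂ volume 2).continuous.tendsto _).comp hz)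
    · simp_rw [bessel_spec]
      exact ((Lp.toTemperedDistributionCLM ℂ volume 2).continuous.tendsto _).comp hf
  let v : HTilde s := ⟨w, f, h1⟩
  have hv : bessel s v = f :=
    toTemperedDistributionCLM_injective ((bessel_spec v).symm.trans h1)
  refine ⟨v, ?_⟩
  rw [tendsto_iff_norm_sub_tendsto_zero] at hf ⊢
  convert hf using 2 with n
  rw [norm_eq, map_sub, hv]

end HTilde

/-- The Fourier transform of the zero extension of `u`, as an absolutely convergent integral; unlike
`𝓕 (zeroExt u)` it is defined at every point, and continuous. -/
def zeroExtFourier (u : Lp ℝ 2 μD) : ℝ → ℂ :=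
  𝓕 fun x : ℝ => (((Ioo (0 : ℝ) 1).indicator (u : ℝ → ℝ) x : ℝ) : ℂ)

theorem integrable_of_L2 (u : Lp ℝ 2 μD) : Integrable (u : ℝ → ℝ) μD :=
  (Lp.memLp u).integrable (by norm_num)

theorem integrable_zeroExt (u : Lp ℝ 2 μD) :
    Integrable fun x : ℝ => (((Ioo (0 : ℝ) 1).indicator (u : ℝ → ℝ) x : ℝ) : ℂ) :=
  ((integrable_indicator_iff measurableSet_Ioo).2 (integrable_of_L2 u)).ofReal

theorem continuous_zeroExtFourier (u : Lp ℝ 2 μD) : Continuous (zeroExtFourier u) :=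
  VectorFourier.fourierIntegral_continuous Real.continuous_fourierChar
    (by exact continuous_inner) (integrable_zeroExt u)

/-- `∫ 𝓕 f · φ = ∫ f · 𝓕 φ`. -/
theorem integral_fourier_mul_eq_flip {f g : ℝ → ℂ} (hf : Integrable f) (hg : Integrable g) :
    ∫ ξ, 𝓕 f ξ * g ξ = ∫ x, f x * 𝓕 g x := by
  have := VectorFourier.integral_fourierIntegral_smul_eq_flip (μ := volume) (ν := volume)
    (L := innerₗ ℝ) Real.continuous_fourierChar (by exact continuous_inner) hf hg
  rw [flip_innerₗ] at this
  exact this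

theorem fourier_zeroExt_ae_eq (u : Lp ℝ 2 μD) :
    (𝓕 (zeroExt u) : Lp ℂ 2 volume) =ᵐ[volume] zeroExtFourier u := by
  refine ae_eq_of_integral_contDiff_smul_eq ((Lp.memLp _).locallyIntegrable (by norm_num))
    (continuous_zeroExtFourier u).locallyIntegrable ?_
  intro φ hφ hφc
  have hg₁ : HasCompactSupport (Complex.ofRealCLM ∘ φ) := hφc.comp_left rfl
  have hg₂ : ContDiff ℝ ∞ (Complex.ofRealCLM ∘ φ) := by fun_prop
  let Φ : 𝓢(ℝ, ℂ) := hg₁.toSchwartzMap hg₂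
  have h := congrArg (fun T => T Φ) (Lp.fourier_toTemperedDistribution_eq (zeroExt u))
  simp only [TemperedDistribution.fourier_apply, Lp.toTemperedDistribution_apply] at h
  have h2 := integral_fourier_mul_eq_flip (integrable_zeroExt u) Φ.integrable
  calc ∫ x, φ x • (𝓕 (zeroExt u) : Lp ℂ 2 volume) x
      = ∫ x, Φ x • (𝓕 (zeroExt u) : Lp ℂ 2 volume) x := by
        refine integral_congr_ae (.of_forall fun x => ?_)
        simp [Φ]
    _ = ∫ x, (𝓕 Φ) x • zeroExt u x := h.symm
    _ = ∫ x, (((Ioo (0 : ℝ) 1).indicator (u : ℝ → ℝ) x : ℝ) : ℂ) * 𝓕 (Φ : ℝ → ℂ) x := by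
        refine integral_congr_ae ?_
        filter_upwards [zeroExt_ae_eq u] with x hx
        rw [hx, SchwartzMap.fourier_coe, smul_eq_mul, mul_comm]
    _ = ∫ x, zeroExtFourier u x * Φ x := h2.symm
    _ = ∫ x, φ x • zeroExtFourier u x := by
        refine integral_congr_ae (.of_forall fun x => ?_)
        simp [Φ, mul_comm]

theorem norm_sq_eq_integral (f : Lp ℂ 2 (volume : Measure ℝ)) :
    ‖f‖ ^ 2 = ∫ x, ‖f x‖ ^ 2 := by
  rw [← real_inner_self_eq_norm_sq, L2.inner_def]
  exact integral_congr_ae (.of_forall fun x => real_inner_self_eq_norm_sq _)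

theorem integrable_norm_sq (f : Lp ℂ 2 (volume : Measure ℝ)) :
    Integrable fun x => ‖f x‖ ^ 2 :=
  (memLp_two_iff_integrable_sq_norm (Lp.memLp f).1).1 (Lp.memLp f)

theorem norm_sq_eq_integral_zeroExtFourier (u : Lp ℝ 2 μD) :
    ‖u‖ ^ 2 = ∫ ξ, ‖zeroExtFourier u ξ‖ ^ 2 := by
  rw [← norm_zeroExt, ← Lp.norm_fourier_eq, norm_sq_eq_integral]
  refine integral_congr_ae ?_
  filter_upwards [fourier_zeroExt_ae_eq u] with ξ h
  rw [h]

theorem integrable_zeroExtFourier_sq (u : Lp ℝ 2 μD) :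
    Integrable fun ξ => ‖zeroExtFourier u ξ‖ ^ 2 := by
  refine (integrable_norm_sq (𝓕 (zeroExt u))).congr ?_
  filter_upwards [fourier_zeroExt_ae_eq u] with ξ h
  rw [h]

namespace HTilde
variable {s : ℝ}

/-- `fourierSide s u = (1 + ξ²)^(s/2) 𝓕 ũ` almost everywhere. -/
theorem fourierSide_ae_eq (u : HTilde s) :
    fourierSide s u =ᵐ[volume] fun ξ =>
      (((1 + ξ ^ 2) ^ (s / 2) : ℝ) : ℂ) * zeroExtFourier (toL2 s u) ξ := by
  filter_upwards [fourierSide_ae_eq_fourier_zeroExt u, fourier_zeroExt_ae_eq (toL2 s u)]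
    with ξ h1 h2
  rw [h1, h2, Real.norm_eq_abs, sq_abs]

end HTilde

/-! ### Compactness of the embedding into `L²(0,1)` -/

instance : IsProbabilityMeasure μD := ⟨by simp⟩

theorem integral_norm_le_norm (u : Lp ℝ 2 μD) : ∫ x, ‖u x‖ ∂μD ≤ ‖u‖ := by
  rw [integral_norm_eq_lintegral_enorm (Lp.memLp u).1, ← eLpNorm_one_eq_lintegral_enorm,
    Lp.norm_def]
  exact ENNReal.toReal_mono (Lp.eLpNorm_ne_top u)
    (eLpNorm_le_eLpNorm_of_exponent_le (by norm_num) (Lp.memLp u).1)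

theorem zeroExtFourier_eq_integral (u : Lp ℝ 2 μD) (ξ : ℝ) :
    zeroExtFourier u ξ = ∫ x, ((Real.fourierChar (-(x * ξ)) : Circle) : ℂ) * (u x : ℂ) ∂μD := by
  rw [zeroExtFourier, Real.fourier_real_eq, ← integral_indicator measurableSet_Ioo]
  refine integral_congr_ae (.of_forall fun x => ?_)
  by_cases hx : x ∈ Ioo (0 : ℝ) 1 <;> simp [hx, Circle.smul_def]

theorem integrable_fourierChar_mul (u : Lp ℝ 2 μD) (ξ : ℝ) :
    Integrable (fun x => ((Real.fourierChar (-(x * ξ)) : Circle) : ℂ) * (u x : ℂ)) μD := by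
  refine (integrable_of_L2 u).ofReal.bdd_mul (c := 1) ?_
    (.of_forall fun x => (Circle.norm_coe _).le)
  exact Continuous.aestronglyMeasurable (by fun_prop)

theorem norm_fourierChar_sub_le (x ξ η : ℝ) :
    ‖((Real.fourierChar (-(x * ξ)) : Circle) : ℂ) - Real.fourierChar (-(x * η))‖ ≤
      2 * Real.pi * |ξ - η| * |x| := by
  have h : ((Real.fourierChar (-(x * ξ)) : Circle) : ℂ) - Real.fourierChar (-(x * η)) =
      Real.fourierChar (-(x * η)) *
        (Complex.exp (Complex.I * ((2 * Real.pi * (x * (η - ξ)) : ℝ) : ℂ)) - 1) := by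
    rw [mul_sub, mul_one, Real.fourierChar_apply, Real.fourierChar_apply, ← Complex.exp_add]
    congr 2
    push_cast
    ring
  rw [h, norm_mul, Circle.norm_coe, one_mul]
  refine (Real.norm_exp_I_mul_ofReal_sub_one_le).trans (le_of_eq ?_)
  rw [Real.norm_eq_abs, abs_mul, abs_mul, abs_mul, abs_sub_comm η, abs_of_pos Real.pi_pos]
  simp
  ring

theorem norm_zeroExtFourier_sub_le (u : Lp ℝ 2 μD) (ξ η : ℝ) :
    ‖zeroExtFourier u ξ - zeroExtFourier u η‖ ≤ 2 * Real.pi * |ξ - η| * ‖u‖ := by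
  rw [zeroExtFourier_eq_integral, zeroExtFourier_eq_integral,
    ← integral_sub (integrable_fourierChar_mul u ξ) (integrable_fourierChar_mul u η)]
  calc _ ≤ ∫ x, 2 * Real.pi * |ξ - η| * ‖u x‖ ∂μD := by
        refine norm_integral_le_of_norm_le ((integrable_of_L2 u).norm.const_mul _) ?_
        filter_upwards [ae_restrict_mem measurableSet_Ioo] with x hx
        rw [← sub_mul, norm_mul, Complex.norm_real]
        gcongr
        refine (norm_fourierChar_sub_le x ξ η).trans (mul_le_of_le_one_right (by positivity) ?_)
        rw [abs_of_pos hx.1]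
        exact hx.2.le
    _ = 2 * Real.pi * |ξ - η| * ∫ x, ‖u x‖ ∂μD := integral_const_mul _ _
    _ ≤ _ := by
        gcongr
        exact integral_norm_le_norm u

theorem norm_zeroExtFourier_le (u : Lp ℝ 2 μD) (ξ : ℝ) : ‖zeroExtFourier u ξ‖ ≤ ‖u‖ := by
  refine le_trans ?_ (integral_norm_le_norm u)
  rw [zeroExtFourier_eq_integral]
  refine norm_integral_le_of_norm_le (integrable_of_L2 u).norm (.of_forall fun x => ?_)
  rw [norm_mul, Circle.norm_coe, one_mul, Complex.norm_real]

/-- The value at `ξ` of the Fourier transform of the zero extension, as a functional on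
`L²(0,1)`. -/
def zeroExtFourierL (ξ : ℝ) : Lp ℝ 2 μD →L[ℝ] ℂ :=
  LinearMap.mkContinuous
    { toFun := fun u => zeroExtFourier u ξ
      map_add' := fun u v => by
        simp_rw [zeroExtFourier_eq_integral]
        rw [← integral_add (integrable_fourierChar_mul u ξ) (integrable_fourierChar_mul v ξ)]
        refine integral_congr_ae ?_
        filter_upwards [Lp.coeFn_add u v] with x hx
        rw [hx]; simp [mul_add]
      map_smul' := fun c u => by
        simp_rw [zeroExtFourier_eq_integral]
        rw [← integral_smul]
        refine integral_congr_ae ?_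
        filter_upwards [Lp.coeFn_smul c u] with x hx
        rw [hx]; simp; ring } 1 fun u => by
    rw [one_mul]
    exact norm_zeroExtFourier_le u ξ

@[simp] theorem zeroExtFourierL_apply (ξ : ℝ) (u : Lp ℝ 2 μD) :
    zeroExtFourierL ξ u = zeroExtFourier u ξ := rfl

namespace HTilde
variable {s : ℝ}

theorem norm_sq_fourierSide_ae_eq (u : HTilde s) :
    (fun ξ => ‖fourierSide s u ξ‖ ^ 2) =ᵐ[volume] fun ξ =>
      (1 + ξ ^ 2) ^ s * ‖zeroExtFourier (toL2 s u) ξ‖ ^ 2 := by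
  filter_upwards [fourierSide_ae_eq u] with ξ h
  rw [h, norm_mul, mul_pow, Complex.norm_real, Real.norm_of_nonneg (by positivity),
    ← Real.rpow_mul_natCast (by positivity)]
  congr 2
  push_cast
  ring

theorem norm_sq_eq_integral (u : HTilde s) :
    ‖u‖ ^ 2 = ∫ ξ, (1 + ξ ^ 2) ^ s * ‖zeroExtFourier (toL2 s u) ξ‖ ^ 2 := by
  rw [← (fourierSide s).norm_map, FracBVP.norm_sq_eq_integral]
  exact integral_congr_ae (norm_sq_fourierSide_ae_eq u)

theorem integrable_weight_mul (u : HTilde s) :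
    Integrable fun ξ => (1 + ξ ^ 2) ^ s * ‖zeroExtFourier (toL2 s u) ξ‖ ^ 2 :=
  (integrable_norm_sq (fourierSide s u)).congr (norm_sq_fourierSide_ae_eq u)

/-- The frequencies in `[-R, R]` contribute at most `2 R κ²` to `‖u‖²_{L²}`; at the others the
`H^s` weight is at least `(1 + R²)^s`. -/
theorem norm_sq_toL2_le (hs : 0 ≤ s) (u : HTilde s) {R κ : ℝ} (hR : 0 ≤ R)
    (hκ : ∀ ξ ∈ Icc (-R) R, ‖zeroExtFourier (toL2 s u) ξ‖ ≤ κ) :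
    ‖toL2 s u‖ ^ 2 ≤ 2 * R * κ ^ 2 + (1 + R ^ 2) ^ (-s) * ‖u‖ ^ 2 := by
  have hint := integrable_zeroExtFourier_sq (toL2 s u)
  rw [norm_sq_eq_integral_zeroExtFourier,
    ← integral_add_compl (measurableSet_Icc (a := -R) (b := R)) hint]
  refine add_le_add ?_ ?_
  · calc _ ≤ ∫ ξ in Icc (-R) R, κ ^ 2 := by
          refine setIntegral_mono_on hint.integrableOn (by simp) measurableSet_Icc fun ξ hξ => ?_
          gcongr
          exact hκ ξ hξ
      _ = _ := by
          rw [setIntegral_const]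
          simp [Measure.real, hR]
          exact Or.inl (by ring)
  · rw [norm_sq_eq_integral, ← integral_const_mul]
    refine (setIntegral_mono_on hint.integrableOn
      ((integrable_weight_mul u).const_mul ((1 + R ^ 2) ^ (-s))).integrableOn
      measurableSet_Icc.compl fun ξ hξ => ?_).trans
      (setIntegral_le_integral ((integrable_weight_mul u).const_mul _)
        (.of_forall fun ξ => by positivity))
    rw [← mul_assoc]
    refine le_mul_of_one_le_left (by positivity) ?_
    rw [Real.rpow_neg (by positivity), ← div_eq_inv_mul, one_le_div (by positivity)]
    refine Real.rpow_le_rpow (by positivity) ?_ hs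
    have : R < |ξ| := by
      by_contra h
      exact hξ (abs_le.1 (not_lt.1 h))
    have := pow_le_pow_left₀ hR this.le 2
    rw [sq_abs] at this
    linarith

/-- If `𝓕 ũ` vanishes on a fine net of `[-R, R]`, it is small on all of `[-R, R]`, being Lipschitz;
the vanishing on the net is finitely many linear conditions on `u`. -/
theorem isCompactOperator_toL2L (hs : 0 < s) : IsCompactOperator (toL2L hs.le) := by
  have := completeSpace hs.le
  refine isCompactOperator_of_forall_small _ fun ε hε => ?_
  have htail : Tendsto (fun R : ℝ => (1 + R ^ 2) ^ (-s)) atTop (𝓝 0) :=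
    (tendsto_rpow_neg_atTop hs).comp
      (tendsto_atTop_add_const_left _ _ (tendsto_pow_atTop (by norm_num)))
  obtain ⟨R, hR, hR0⟩ := ((htail.eventually (ge_mem_nhds (by positivity : 0 < ε ^ 2 / 2))).and
    (eventually_gt_atTop 0)).exists
  obtain ⟨δ, hδ0, hδ⟩ : ∃ δ > 0, 2 * R * (2 * Real.pi * δ) ^ 2 ≤ ε ^ 2 / 2 := by
    have : Tendsto (fun δ : ℝ => 2 * R * (2 * Real.pi * δ) ^ 2) (𝓝[>] 0) (𝓝 0) := by
      have : Continuous fun δ : ℝ => 2 * R * (2 * Real.pi * δ) ^ 2 := by fun_prop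
      simpa using (this.tendsto 0).mono_left nhdsWithin_le_nhds
    obtain ⟨δ, h1, h2⟩ := ((this.eventually (ge_mem_nhds (by positivity : 0 < ε ^ 2 / 2))).and
      self_mem_nhdsWithin).exists
    exact ⟨δ, h2, h1⟩
  obtain ⟨t, -, htf, ht⟩ := (isCompact_Icc (a := -R) (b := R)).finite_cover_balls hδ0
  have := htf.fintype
  refine ⟨t → ℂ, inferInstance, inferInstance, inferInstance,
    ContinuousLinearMap.pi fun ξ => (zeroExtFourierL ξ) ∘L toL2L hs.le, fun u hu => ?_⟩
  have hκ : ∀ ξ ∈ Icc (-R) R, ‖zeroExtFourier (toL2 s u) ξ‖ ≤ 2 * Real.pi * δ * ‖u‖ := by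
    intro ξ hξ
    obtain ⟨η, hη, hd⟩ := mem_iUnion₂.1 (ht hξ)
    have h0 : zeroExtFourier (toL2 s u) η = 0 := congrFun hu ⟨η, hη⟩
    have h1 := norm_zeroExtFourier_sub_le (toL2 s u) ξ η
    rw [h0, sub_zero] at h1
    refine h1.trans ?_
    gcongr
    · exact (Metric.mem_ball.1 hd).le
    · exact norm_toL2_le hs.le u
  have h := norm_sq_toL2_le hs.le u hR0.le hκ
  refine abs_le_of_sq_le_sq' ?_ (by positivity) |>.2
  rw [toL2L_apply]
  have h3 := mul_le_mul_of_nonneg_right hδ (sq_nonneg ‖u‖)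
  have h4 := mul_le_mul_of_nonneg_right hR (sq_nonneg ‖u‖)
  calc _ ≤ _ := h
    _ ≤ _ := by nlinarith

end HTilde

/-! ### The Fourier transform of the Riemann–Liouville kernel -/

/-- The Laplace transform of `t ^ (a - 1)` at a complex point of the right half-plane. The case of
real `r` is `Complex.integral_cpow_mul_exp_neg_mul_Ioi`; both sides are holomorphic in `r`. -/
theorem integral_rpow_mul_cexp_neg_mul_Ioi {a : ℝ} (ha : 0 < a) {r : ℂ} (hr : 0 < r.re) :
    ∫ t in Ioi (0 : ℝ), ((t ^ (a - 1) : ℝ) : ℂ) * Complex.exp (-(r * t)) =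
      (1 / r) ^ (a : ℂ) * Real.Gamma a := by
  let ν : Measure ℝ := (volume.restrict (Ioi (0 : ℝ))).withDensity
    fun t => ENNReal.ofReal (t ^ (a - 1))
  have hmeas : Measurable fun t : ℝ => ENNReal.ofReal (t ^ (a - 1)) := by fun_prop
  have hfin : ∀ᵐ t ∂(volume.restrict (Ioi (0 : ℝ))), ENNReal.ofReal (t ^ (a - 1)) < ⊤ :=
    .of_forall fun _ => ENNReal.ofReal_lt_top
  let X : ℝ → ℝ := fun t => -t
  have hval : ∀ z : ℂ, ProbabilityTheory.complexMGF X ν z =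
      ∫ t in Ioi (0 : ℝ), ((t ^ (a - 1) : ℝ) : ℂ) * Complex.exp (-(z * t)) := by
    intro z
    rw [ProbabilityTheory.complexMGF, integral_withDensity_eq_integral_toReal_smul hmeas hfin]
    refine setIntegral_congr_fun measurableSet_Ioi fun t ht => ?_
    rw [mem_Ioi] at ht
    simp only [X]
    rw [ENNReal.toReal_ofReal (by positivity), Complex.real_smul]
    push_cast
    ring_nf
  have hset : {z : ℂ | 0 < z.re} ⊆
      {z : ℂ | z.re ∈ interior (ProbabilityTheory.integrableExpSet X ν)} := by
    have : Ioi (0 : ℝ) ⊆ ProbabilityTheory.integrableExpSet X ν := by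
      intro y hy
      rw [mem_Ioi] at hy
      change Integrable _ _
      rw [integrable_withDensity_iff_integrable_smul' hmeas hfin]
      have h := integrableOn_rpow_mul_exp_neg_mul_rpow (p := 1) (s := a - 1) (b := y)
        (by linarith) (by norm_num) hy
      refine IntegrableOn.congr_fun h (fun t ht => ?_) measurableSet_Ioi
      rw [mem_Ioi] at ht
      simp only [X]
      rw [ENNReal.toReal_ofReal (by positivity), smul_eq_mul, Real.rpow_one]
      ring_nf
    intro z hz
    exact interior_maximal this isOpen_Ioi hz
  have hF : AnalyticOnNhd ℂ (ProbabilityTheory.complexMGF X ν) {z : ℂ | 0 < z.re} :=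
    ProbabilityTheory.analyticOnNhd_complexMGF.mono hset
  have hopen : IsOpen {z : ℂ | 0 < z.re} := isOpen_lt continuous_const Complex.continuous_re
  have hG : AnalyticOnNhd ℂ (fun z : ℂ => (1 / z) ^ (a : ℂ) * (Real.Gamma a : ℂ))
      {z : ℂ | 0 < z.re} := by
    refine DifferentiableOn.analyticOnNhd (fun z hz => ?_) hopen
    rw [mem_ofPred_eq] at hz
    have hz0 : z ≠ 0 := by rintro rfl; simp at hz
    refine DifferentiableAt.differentiableWithinAt ?_
    refine (DifferentiableAt.cpow (by fun_prop (disch := assumption)) (by fun_prop) ?_).mul_const _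
    left
    rw [one_div, Complex.inv_re]
    exact div_pos hz (Complex.normSq_pos.2 hz0)
  have hpre : IsPreconnected {z : ℂ | 0 < z.re} := (convex_halfSpace_re_gt 0).isPreconnected
  have key := hF.eqOn_of_preconnected_of_frequently_eq hG hpre (z₀ := 1) (by simp) ?_
  · rw [← hval]
    exact key hr
  · have hreal : ∀ x : ℝ, 0 < x → ProbabilityTheory.complexMGF X ν x =
        (1 / (x : ℂ)) ^ (a : ℂ) * Real.Gamma a := by
      intro x hx
      rw [hval, ← Complex.Gamma_ofReal,
        ← Complex.integral_cpow_mul_exp_neg_mul_Ioi (by simpa using ha) hx]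
      refine setIntegral_congr_fun measurableSet_Ioi fun t ht => ?_
      rw [mem_Ioi] at ht
      rw [Complex.ofReal_cpow ht.le]
      push_cast
      rfl
    have ht : Tendsto (fun x : ℝ => (x : ℂ)) (𝓝[>] 1) (𝓝[≠] 1) := by
      refine tendsto_nhdsWithin_iff.2 ⟨?_, ?_⟩
      · exact (Complex.continuous_ofReal.tendsto 1).mono_left nhdsWithin_le_nhds
      · filter_upwards [self_mem_nhdsWithin] with x hx
        simpa using (ne_of_gt hx)
    refine ht.frequently (Eventually.frequently ?_)
    filter_upwards [self_mem_nhdsWithin] with x hx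
    exact hreal x (lt_trans one_pos hx)

/-- The kernel `t_+^(-β) e^(-ε t) / Γ(1 - β)` of the Riemann–Liouville integral of order `1 - β`,
damped by `e^(-ε t)` to make it integrable. -/
def fracKernel (β ε : ℝ) (t : ℝ) : ℝ :=
  (Ioi (0 : ℝ)).indicator (fun t => 1 / Real.Gamma (1 - β) * (t ^ (-β) * Real.exp (-(ε * t)))) t

variable {β ε σ : ℝ}

theorem integrable_fracKernel (hβ : β < 1) (hε : 0 < ε) : Integrable (fracKernel β ε) := by
  refine (integrable_indicator_iff measurableSet_Ioi).2 (Integrable.const_mul ?_ _)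
  have := integrableOn_rpow_mul_exp_neg_mul_rpow (p := 1) (s := -β) (b := ε)
    (by linarith) (by norm_num) hε
  simpa [IntegrableOn] using this

/-- The Fourier transform of the damped kernel is `(ε + 2πiξ)^(β - 1)`. -/
theorem fourier_fracKernel (hβ : β < 1) (hε : 0 < ε) (ξ : ℝ) :
    ∫ t, ((fracKernel β ε t : ℝ) : ℂ) * Complex.exp (-(2 * Real.pi * Complex.I * ξ * t)) =
      (1 / (ε + 2 * Real.pi * Complex.I * ξ)) ^ ((1 - β : ℝ) : ℂ) := by
  have hΓ : (Real.Gamma (1 - β) : ℂ) ≠ 0 :=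
    Complex.ofReal_ne_zero.2 (Real.Gamma_pos_of_pos (by linarith)).ne'
  have h := integral_rpow_mul_cexp_neg_mul_Ioi (a := 1 - β) (by linarith)
    (r := ε + 2 * Real.pi * Complex.I * ξ) (by simpa using hε)
  rw [eq_comm, ← eq_div_iff hΓ] at h
  rw [h, ← integral_indicator measurableSet_Ioi, div_eq_inv_mul, ← integral_const_mul]
  refine integral_congr_ae (.of_forall fun t => ?_)
  by_cases ht : t ∈ Ioi (0 : ℝ)
  · simp only [fracKernel, indicator_of_mem ht]
    rw [show -((ε + 2 * Real.pi * Complex.I * ξ) * (t : ℂ)) =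
      -(ε * t) + -(2 * Real.pi * Complex.I * ξ * t) by ring, Complex.exp_add,
      show 1 - β - 1 = -β by ring]
    push_cast
    ring
  · simp [fracKernel, ht]

/-- The kernels of the left-sided (`σ = 1`) and the right-sided (`σ = -1`) integral together. -/
theorem fourier_fracKernel_comp_mul (hβ : β < 1) (hε : 0 < ε) (hσ : σ = 1 ∨ σ = -1) (ξ : ℝ) :
    𝓕 (fun t : ℝ => ((fracKernel β ε (σ * t) : ℝ) : ℂ)) ξ =
      (1 / (ε + 2 * Real.pi * Complex.I * (σ * ξ))) ^ ((1 - β : ℝ) : ℂ) := by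
  rw [Real.fourier_real_eq_integral_exp_smul]
  rcases hσ with rfl | rfl
  · have := fourier_fracKernel hβ hε ξ
    simp only [one_mul, Complex.ofReal_one]
    rw [← this]
    refine integral_congr_ae (.of_forall fun t => ?_)
    simp only [smul_eq_mul]
    rw [mul_comm]
    push_cast
    ring_nf
  · have := fourier_fracKernel hβ hε (-ξ)
    rw [← integral_neg_eq_self] at this
    simp only [Complex.ofReal_neg, neg_mul, one_mul, Complex.ofReal_one] at this ⊢
    rw [← this]
    refine integral_congr_ae (.of_forall fun t => ?_)
    simp only [smul_eq_mul]
    rw [mul_comm]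
    push_cast
    ring_nf

theorem integrable_fracKernel_comp_mul (hβ : β < 1) (hε : 0 < ε) (hσ : σ = 1 ∨ σ = -1) :
    Integrable (fun t : ℝ => ((fracKernel β ε (σ * t) : ℝ) : ℂ)) := by
  refine Integrable.ofReal ?_
  refine (integrable_fracKernel hβ hε).comp_mul_left' ?_
  rcases hσ with rfl | rfl <;> norm_num

/-- The pairing of the damped fractional integral of `u` with `Ψ`, in terms of Fourier
transforms. -/
theorem integral_convolution_mul_eq (hβ : β < 1) (hε : 0 < ε) (hσ : σ = 1 ∨ σ = -1)
    (u : Lp ℝ 2 μD) (Ψ : 𝓢(ℝ, ℂ)) :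
    ∫ y, (∫ x, (((Ioo (0 : ℝ) 1).indicator (u : ℝ → ℝ) x : ℝ) : ℂ) *
        ((fracKernel β ε (σ * (y - x)) : ℝ) : ℂ)) * Ψ y =
      ∫ ξ, zeroExtFourier u ξ * (1 / (ε + 2 * Real.pi * Complex.I * (σ * ξ))) ^ ((1 - β : ℝ) : ℂ) *
        𝓕⁻ Ψ ξ := by
  have hU := integrable_zeroExt u
  have hk := integrable_fracKernel_comp_mul hβ hε hσ
  have h := integral_fourier_mul_eq_flip (hU.integrable_convolution (.mul ℂ ℂ) hk)
    (𝓕⁻ Ψ).integrable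
  simp_rw [Real.fourier_mul_convolution_eq hU hk, fourier_fracKernel_comp_mul hβ hε hσ] at h
  rw [zeroExtFourier, h]
  refine integral_congr_ae (.of_forall fun y => ?_)
  simp only
  rw [← SchwartzMap.fourier_coe, fourier_fourierInv_eq]
  rfl

/-! ### The symbol of the fractional derivative -/

/-- The symbol `(2πiσξ)^β` of the left-sided (`σ = 1`) or right-sided (`σ = -1`) derivative of
order `β`. -/
def fracSymbol (β σ ξ : ℝ) : ℂ := (2 * Real.pi * Complex.I * (σ * ξ)) ^ (β : ℂ)

theorem norm_two_pi_I_mul (hσ : σ = 1 ∨ σ = -1) (ξ : ℝ) :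
    ‖(2 * Real.pi * Complex.I * (σ * ξ) : ℂ)‖ = 2 * Real.pi * |ξ| := by
  have : |σ| = 1 := by rcases hσ with rfl | rfl <;> simp
  simp [abs_of_pos Real.pi_pos, this]

theorem norm_fracSymbol (hσ : σ = 1 ∨ σ = -1) (ξ : ℝ) :
    ‖fracSymbol β σ ξ‖ = (2 * Real.pi * |ξ|) ^ β := by
  rw [fracSymbol, Complex.norm_cpow_real, norm_two_pi_I_mul hσ]

theorem measurable_fracSymbol : Measurable (fracSymbol β σ) := by
  unfold fracSymbol
  fun_prop

theorem ne_zero_of_eq_one_or (hσ : σ = 1 ∨ σ = -1) : σ ≠ 0 := by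
  rcases hσ with rfl | rfl <;> norm_num

theorem arg_two_pi_I_mul_ne_pi (ξ : ℝ) :
    (2 * Real.pi * Complex.I * (σ * ξ) : ℂ).arg ≠ Real.pi := by
  intro h
  have := (Complex.arg_eq_pi_iff.1 h).1
  simp at this

theorem one_div_cpow_mul_eq (hσ : σ = 1 ∨ σ = -1) {ξ : ℝ} (hξ : ξ ≠ 0) :
    (1 / (2 * Real.pi * Complex.I * (σ * ξ) : ℂ)) ^ ((1 - β : ℝ) : ℂ) *
      (2 * Real.pi * Complex.I * ξ) = σ * fracSymbol β σ ξ := by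
  have hz : (2 * Real.pi * Complex.I * (σ * ξ) : ℂ) ≠ 0 := by
    simp [hξ, ne_zero_of_eq_one_or hσ, Real.pi_ne_zero]
  have hσ2 : (σ : ℂ) * σ = 1 := by rcases hσ with rfl | rfl <;> simp
  have h1 : (2 * Real.pi * Complex.I * ξ : ℂ) = σ * (2 * Real.pi * Complex.I * (σ * ξ)) := by
    linear_combination (-(2 * Real.pi * Complex.I * ξ : ℂ)) * hσ2
  rw [h1, one_div, Complex.inv_cpow _ _ (arg_two_pi_I_mul_ne_pi ξ), fracSymbol, mul_left_comm,
    ← Complex.cpow_neg]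
  congr 1
  nth_rewrite 2 [← Complex.cpow_one (2 * Real.pi * Complex.I * (σ * ξ) : ℂ)]
  rw [← Complex.cpow_add _ _ hz]
  congr 1
  push_cast
  ring

theorem fourierInv_lineDerivOp_apply (Φ : 𝓢(ℝ, ℂ)) (ξ : ℝ) :
    𝓕⁻ (∂_{(1 : ℝ)} Φ) ξ = -(2 * Real.pi * Complex.I * ξ) * 𝓕⁻ Φ ξ := by
  have : (fun x : ℝ => inner ℝ x (1 : ℝ)).HasTemperateGrowth := by fun_prop
  rw [SchwartzMap.fourierInv_lineDerivOp_eq, smul_apply,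
    SchwartzMap.smulLeftCLM_apply_apply this]
  simp
  ring

/-- Removing the damping: `(ε + 2πiσξ)^(β - 1) (-2πiξ) → -σ (2πiσξ)^β` as `ε → 0`, dominated by
`1 + 2π|ξ|`. -/
theorem tendsto_integral_resolvent_symbol (hβ0 : 0 < β) (hβ : β < 1) (hσ : σ = 1 ∨ σ = -1)
    (u : Lp ℝ 2 μD) (Φ : 𝓢(ℝ, ℂ)) :
    Tendsto (fun ε : ℝ => ∫ ξ, zeroExtFourier u ξ *
        (1 / (ε + 2 * Real.pi * Complex.I * (σ * ξ))) ^ ((1 - β : ℝ) : ℂ) *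
        𝓕⁻ (∂_{(1 : ℝ)} Φ) ξ) (𝓝[>] 0)
      (𝓝 (-σ * ∫ ξ, fracSymbol β σ ξ * zeroExtFourier u ξ * 𝓕⁻ Φ ξ)) := by
  have hne : ∀ᵐ ξ : ℝ, ξ ≠ 0 := by simp [ae_iff]
  have hlim : (-σ * ∫ ξ, fracSymbol β σ ξ * zeroExtFourier u ξ * 𝓕⁻ Φ ξ) =
      ∫ ξ, zeroExtFourier u ξ *
        (1 / (2 * Real.pi * Complex.I * (σ * ξ))) ^ ((1 - β : ℝ) : ℂ) *
        𝓕⁻ (∂_{(1 : ℝ)} Φ) ξ := by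
    rw [← integral_const_mul]
    refine integral_congr_ae ?_
    filter_upwards [hne] with ξ hξ
    rw [fourierInv_lineDerivOp_apply]
    linear_combination (zeroExtFourier u ξ * 𝓕⁻ Φ ξ) * one_div_cpow_mul_eq (β := β) hσ hξ
  rw [hlim]
  have hmeas : Measurable (zeroExtFourier u) := (continuous_zeroExtFourier u).measurable
  have hpos : ∀ᶠ ε : ℝ in 𝓝[>] 0, 0 < ε := self_mem_nhdsWithin
  refine tendsto_integral_filter_of_dominated_convergence
    (fun ξ => ‖u‖ * (‖𝓕⁻ Φ ξ‖ + 2 * Real.pi * (‖ξ‖ ^ 1 * ‖𝓕⁻ Φ ξ‖))) ?_ ?_ ?_ ?_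
  · refine .of_forall fun ε => ?_
    have h1 : Measurable fun ξ : ℝ =>
      (1 / (ε + 2 * Real.pi * Complex.I * (σ * ξ)) : ℂ) ^ ((1 - β : ℝ) : ℂ) := by fun_prop
    exact ((hmeas.mul h1).mul (𝓕⁻ (∂_{(1 : ℝ)} Φ)).continuous.measurable).aestronglyMeasurable
  · filter_upwards [hpos] with ε hε
    filter_upwards [hne] with ξ hξ
    have hξ' : 0 < |ξ| := abs_pos.2 hξ
    rw [norm_mul, norm_mul, mul_assoc, fourierInv_lineDerivOp_apply, norm_mul]
    refine mul_le_mul (norm_zeroExtFourier_le u ξ) ?_ (by positivity) (norm_nonneg _)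
    have hpi := Real.pi_pos
    have h1 : ‖(1 / (ε + 2 * Real.pi * Complex.I * (σ * ξ)) : ℂ) ^ ((1 - β : ℝ) : ℂ)‖ ≤
        (2 * Real.pi * |ξ|) ^ (-(1 - β)) := by
      rw [Complex.norm_cpow_real, norm_div, norm_one, one_div, Real.inv_rpow (norm_nonneg _),
        Real.rpow_neg (by positivity)]
      refine inv_anti₀ (by positivity) (Real.rpow_le_rpow (by positivity) ?_ (by linarith))
      rw [← norm_two_pi_I_mul hσ]
      refine le_trans (le_of_eq ?_) ((Complex.abs_im_le_norm _).trans (le_of_eq rfl))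
      rw [show (2 * Real.pi * Complex.I * (σ * ξ) : ℂ) =
        ((2 * Real.pi * (σ * ξ) : ℝ) : ℂ) * Complex.I by push_cast; ring]
      simp
    have h2 : ‖-(2 * Real.pi * Complex.I * ξ : ℂ)‖ = 2 * Real.pi * |ξ| := by
      simp [abs_of_pos hpi]
    rw [h2, ← mul_assoc]
    calc _ ≤ (2 * Real.pi * |ξ|) ^ (-(1 - β)) * (2 * Real.pi * |ξ|) * ‖𝓕⁻ Φ ξ‖ := by gcongr
      _ = (2 * Real.pi * |ξ|) ^ β * ‖𝓕⁻ Φ ξ‖ := by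
        congr 1
        nth_rewrite 2 [← Real.rpow_one (2 * Real.pi * |ξ|)]
        rw [← Real.rpow_add (by positivity)]
        ring_nf
      _ ≤ (1 + 2 * Real.pi * |ξ|) * ‖𝓕⁻ Φ ξ‖ := by
        gcongr
        refine (Real.rpow_le_rpow (by positivity) (le_add_of_nonneg_left zero_le_one)
          hβ0.le).trans ?_
        exact Real.rpow_le_self_of_one_le (by linarith [mul_pos (mul_pos two_pos hpi) hξ']) hβ.le
      _ = _ := by rw [Real.norm_eq_abs]; ring
  · exact (((𝓕⁻ Φ).integrable.norm).add
      (((𝓕⁻ Φ).integrable_pow_mul volume 1).const_mul _)).const_mul _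
  · filter_upwards [hne] with ξ hξ
    refine Tendsto.mul_const _ (Tendsto.const_mul _ ?_)
    have hz : (2 * Real.pi * Complex.I * (σ * ξ) : ℂ) ≠ 0 := by
      simp [hξ, ne_zero_of_eq_one_or hσ, Real.pi_ne_zero]
    have hc : ContinuousAt (fun ε : ℝ =>
        (1 / (ε + 2 * Real.pi * Complex.I * (σ * ξ)) : ℂ) ^ ((1 - β : ℝ) : ℂ)) 0 := by
      refine ContinuousAt.cpow (ContinuousAt.div (by fun_prop) (by fun_prop) (by simpa using hz))
        (by fun_prop) ?_
      rw [Complex.ofReal_zero, zero_add, one_div, Complex.mem_slitPlane_iff_arg, Complex.arg_inv,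
        if_neg (arg_two_pi_I_mul_ne_pi ξ)]
      refine ⟨?_, inv_ne_zero hz⟩
      intro h
      have h3 := Complex.neg_pi_lt_arg (2 * Real.pi * Complex.I * (σ * ξ) : ℂ)
      linarith
    have := hc.tendsto.mono_left (nhdsWithin_le_nhds (s := Ioi 0))
    simpa using this

/-- The symbol of the fractional derivative relative to the `H^β` weight; it is bounded. -/
def normSymbol (β σ ξ : ℝ) : ℂ := fracSymbol β σ ξ * (((1 + ξ ^ 2) ^ (-β / 2) : ℝ) : ℂ)

theorem memLp_top_normSymbol (hβ0 : 0 < β) (hσ : σ = 1 ∨ σ = -1) :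
    MemLp (normSymbol β σ) ⊤ volume := by
  refine memLp_top_of_bound (C := (2 * Real.pi) ^ β) ?_ (.of_forall fun ξ => ?_)
  · exact (measurable_fracSymbol.mul (by fun_prop)).aestronglyMeasurable
  · rw [normSymbol, norm_mul, norm_fracSymbol hσ, Complex.norm_real,
      Real.norm_of_nonneg (by positivity), Real.mul_rpow (by positivity) (abs_nonneg _), mul_assoc]
    refine mul_le_of_le_one_right (by positivity) ?_
    rw [neg_div, Real.rpow_neg (by positivity), ← div_eq_mul_inv, div_le_one (by positivity)]
    calc |ξ| ^ β = (|ξ| ^ 2) ^ (β / 2) := by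
          rw [← Real.rpow_natCast_mul (abs_nonneg _)]; congr 1; push_cast; ring
      _ ≤ _ := by
          refine Real.rpow_le_rpow (by positivity) ?_ (by positivity)
          rw [sq_abs]; linarith

/-- The map `u ↦ (2πiσξ)^β 𝓕 ũ` from `H̃^β(0,1)` to `L²(ℝ)`, obtained from `HTilde.fourierSide` by
multiplication with the bounded function `normSymbol`. -/
def fracDerivFourier (hβ0 : 0 < β) (hσ : σ = 1 ∨ σ = -1) :
    HTilde β →L[ℝ] Lp ℂ 2 (volume : Measure ℝ) :=
  (((ContinuousLinearMap.mul ℂ ℂ).holderL volume ⊤ 2 2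
    ((memLp_top_normSymbol hβ0 hσ).toLp _)).restrictScalars ℝ) ∘L
      (HTilde.fourierSide β).toContinuousLinearMap

theorem fracDerivFourier_ae_eq_mul_fourierSide (hβ0 : 0 < β) (hσ : σ = 1 ∨ σ = -1) (u : HTilde β) :
    fracDerivFourier hβ0 hσ u =ᵐ[volume]
      fun ξ => normSymbol β σ ξ * HTilde.fourierSide β u ξ := by
  filter_upwards [ContinuousLinearMap.coeFn_holder (r := 2) (ContinuousLinearMap.mul ℂ ℂ)
    ((memLp_top_normSymbol hβ0 hσ).toLp _) (HTilde.fourierSide β u),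
    (memLp_top_normSymbol hβ0 hσ).coeFn_toLp] with ξ h1 h2
  refine h1.trans ?_
  rw [h2]
  rfl

theorem fracDerivFourier_ae_eq (hβ0 : 0 < β) (hσ : σ = 1 ∨ σ = -1) (u : HTilde β) :
    fracDerivFourier hβ0 hσ u =ᵐ[volume]
      fun ξ => fracSymbol β σ ξ * zeroExtFourier (HTilde.toL2 β u) ξ := by
  filter_upwards [fracDerivFourier_ae_eq_mul_fourierSide hβ0 hσ u, HTilde.fourierSide_ae_eq u]
    with ξ h1 h2
  rw [h1, h2, normSymbol, mul_assoc, ← mul_assoc (((1 + ξ ^ 2) ^ (-β / 2) : ℝ) : ℂ),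
    ← Complex.ofReal_mul, ← Real.rpow_add (by positivity)]
  rw [show -β / 2 + β / 2 = 0 by ring, Real.rpow_zero, Complex.ofReal_one, one_mul]

/-- The fractional derivative of `ũ` on the whole line, `𝓕⁻¹ ((2πiσξ)^β 𝓕 ũ)`. -/
def fracDeriv (hβ0 : 0 < β) (hσ : σ = 1 ∨ σ = -1) (u : HTilde β) : Lp ℂ 2 (volume : Measure ℝ) :=
  𝓕⁻ (fracDerivFourier hβ0 hσ u)

theorem integral_fracDeriv_mul (hβ0 : 0 < β) (hσ : σ = 1 ∨ σ = -1) (u : HTilde β) (Φ : 𝓢(ℝ, ℂ)) :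
    ∫ x, fracDeriv hβ0 hσ u x * Φ x =
      ∫ ξ, fracSymbol β σ ξ * zeroExtFourier (HTilde.toL2 β u) ξ * 𝓕⁻ Φ ξ := by
  have h := congrArg (fun T => T Φ)
    (Lp.fourierInv_toTemperedDistribution_eq (fracDerivFourier hβ0 hσ u))
  simp only [TemperedDistribution.fourierInv_apply, Lp.toTemperedDistribution_apply,
    smul_eq_mul] at h
  calc _ = ∫ x, Φ x * (𝓕⁻ (fracDerivFourier hβ0 hσ u) : Lp ℂ 2 volume) x := by
        exact integral_congr_ae (.of_forall fun x => mul_comm _ _)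
    _ = _ := h.symm
    _ = _ := by
        refine integral_congr_ae ?_
        filter_upwards [fracDerivFourier_ae_eq hβ0 hσ u] with ξ hξ
        rw [hξ, mul_comm]

/-- `fracDeriv` is `σ` times the distributional derivative on `ℝ` of the fractional integral of `ũ`,
the latter taken as the limit of the damped integrals. -/
theorem tendsto_integral_convolution_mul (hβ0 : 0 < β) (hβ : β < 1) (hσ : σ = 1 ∨ σ = -1)
    (u : HTilde β) (Φ : 𝓢(ℝ, ℂ)) :
    Tendsto (fun ε : ℝ => ∫ y, (∫ x, (((Ioo (0 : ℝ) 1).indicator u x : ℝ) : ℂ) *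
        ((fracKernel β ε (σ * (y - x)) : ℝ) : ℂ)) * ∂_{(1 : ℝ)} Φ y) (𝓝[>] 0)
      (𝓝 (-σ * ∫ x, fracDeriv hβ0 hσ u x * Φ x)) := by
  rw [integral_fracDeriv_mul]
  refine (tendsto_integral_resolvent_symbol hβ0 hβ hσ (HTilde.toL2 β u) Φ).congr' ?_
  filter_upwards [self_mem_nhdsWithin] with ε hε
  exact (integral_convolution_mul_eq hβ hε hσ (HTilde.toL2 β u) (∂_{(1 : ℝ)} Φ)).symm

/-! ### Weak fractional derivatives as Fourier multipliers -/

/-- A real test function, as a complex-valued Schwartz function. -/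
def testSchwartz {φ : ℝ → ℝ} (hφ : ContDiff ℝ ∞ φ) (hc : HasCompactSupport φ) : 𝓢(ℝ, ℂ) :=
  HasCompactSupport.toSchwartzMap (f := fun x => (φ x : ℂ))
    (hc.comp_left Complex.ofReal_zero) (Complex.ofRealCLM.contDiff.comp hφ)

@[simp] theorem testSchwartz_apply {φ : ℝ → ℝ} (hφ : ContDiff ℝ ∞ φ) (hc : HasCompactSupport φ)
    (x : ℝ) : testSchwartz hφ hc x = φ x := rfl

theorem lineDerivOp_testSchwartz {φ : ℝ → ℝ} (hφ : ContDiff ℝ ∞ φ) (hc : HasCompactSupport φ)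
    (x : ℝ) : ∂_{(1 : ℝ)} (testSchwartz hφ hc) x = ((deriv φ x : ℝ) : ℂ) := by
  have h : HasDerivAt (testSchwartz hφ hc) ((deriv φ x : ℝ) : ℂ) x :=
    ((hφ.differentiable (by simp) x).hasDerivAt).ofReal_comp
  rw [SchwartzMap.lineDerivOp_apply_eq_fderiv, fderiv_apply_one_eq_deriv, h.deriv]

theorem deriv_eq_zero_of_notMem {φ : ℝ → ℝ} {s : Set ℝ} (h : tsupport φ ⊆ s) {x : ℝ}
    (hx : x ∉ s) : deriv φ x = 0 :=
  Function.notMem_support.1 fun hx' => hx (h (support_deriv_subset hx'))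

theorem eq_zero_of_notMem {φ : ℝ → ℝ} {s : Set ℝ} (h : tsupport φ ⊆ s) {x : ℝ}
    (hx : x ∉ s) : φ x = 0 :=
  Function.notMem_support.1 fun hx' => hx (h (subset_tsupport _ hx'))

theorem fracKernel_of_nonpos {t : ℝ} (ht : t ≤ 0) : fracKernel β ε t = 0 :=
  indicator_of_notMem (by simpa using ht) _

/-- The left-sided derivative of `ũ` vanishes to the left of `(0,1)`, the right-sided one to the
right of it. -/
theorem fracDeriv_ae_eq_zero_of_disjoint (hβ0 : 0 < β) (hβ : β < 1) (hσ : σ = 1 ∨ σ = -1)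
    (u : HTilde β) {O : Set ℝ} (hO : IsOpen O)
    (hdis : ∀ y ∈ O, ∀ x ∈ Ioo (0 : ℝ) 1, σ * (y - x) ≤ 0) :
    ∀ᵐ y, y ∈ O → fracDeriv hβ0 hσ u y = 0 := by
  refine hO.ae_eq_zero_of_integral_contDiff_smul_eq_zero
    (((Lp.memLp (fracDeriv hβ0 hσ u)).locallyIntegrable (by norm_num)).locallyIntegrableOn O) ?_
  intro φ hφ hc hsupp
  have h := tendsto_integral_convolution_mul hβ0 hβ hσ u (testSchwartz hφ hc)
  have h0 : ∀ ε : ℝ, ∫ y, (∫ x, (((Ioo (0 : ℝ) 1).indicator u x : ℝ) : ℂ) *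
        ((fracKernel β ε (σ * (y - x)) : ℝ) : ℂ)) * ∂_{(1 : ℝ)} (testSchwartz hφ hc) y = 0 := by
    intro ε
    rw [← integral_zero ℝ ℂ (μ := volume)]
    refine integral_congr_ae (.of_forall fun y => ?_)
    by_cases hy : y ∈ O
    · have : ∫ x, (((Ioo (0 : ℝ) 1).indicator u x : ℝ) : ℂ) *
          ((fracKernel β ε (σ * (y - x)) : ℝ) : ℂ) = 0 := by
        rw [← integral_zero ℝ ℂ (μ := volume)]
        refine integral_congr_ae (.of_forall fun x => ?_)
        by_cases hx : x ∈ Ioo (0 : ℝ) 1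
        · simp [fracKernel_of_nonpos (hdis y hy x hx)]
        · simp [hx]
      simp only [this, zero_mul]
    · simp only [lineDerivOp_testSchwartz, deriv_eq_zero_of_notMem hsupp hy, Complex.ofReal_zero,
        mul_zero]
  simp_rw [h0] at h
  have h1 := tendsto_nhds_unique h tendsto_const_nhds
  have hσ0 : (-σ : ℂ) ≠ 0 := by
    simpa using ne_zero_of_eq_one_or hσ
  rw [← (mul_eq_zero.1 h1).resolve_left hσ0]
  refine integral_congr_ae (.of_forall fun y => ?_)
  simp [mul_comm]

/-- The undamped kernel, cut off at `1`. The cut-off makes it integrable, and is not seen by points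
of `(0,1)`. -/
def truncKernel (β t : ℝ) : ℝ :=
  (Ioo (0 : ℝ) 1).indicator (fun t => 1 / Real.Gamma (1 - β) * t ^ (-β)) t

theorem integrable_truncKernel (hβ : β < 1) : Integrable (truncKernel β) := by
  refine (integrable_indicator_iff measurableSet_Ioo).2 (Integrable.const_mul ?_ _)
  exact (intervalIntegral.integrableOn_Ioo_rpow_iff one_pos).2 (by linarith)

theorem fracKernel_eq_truncKernel_mul {t : ℝ} (ht : t < 1) :
    fracKernel β ε t = truncKernel β t * Real.exp (-(ε * t)) := by
  by_cases h : 0 < t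
  · rw [fracKernel, truncKernel, indicator_of_mem (mem_Ioi.2 h),
      indicator_of_mem (mem_Ioo.2 ⟨h, ht⟩), mul_assoc]
  · rw [fracKernel_of_nonpos (not_lt.1 h), truncKernel, indicator_of_notMem (fun h' => h h'.1),
      zero_mul]

/-- The left-sided (`σ = 1`) or right-sided (`σ = -1`) fractional integral of order `1 - β`;
the cut-off in `truncKernel` makes this right only for `y ∈ (0,1)`. -/
def fracInt (β σ : ℝ) (f : ℝ → ℝ) (y : ℝ) : ℝ :=
  ∫ x, (Ioo (0 : ℝ) 1).indicator f x * truncKernel β (σ * (y - x))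

theorem integrable_truncKernel_comp_mul (hβ : β < 1) (hσ : σ = 1 ∨ σ = -1) :
    Integrable fun t => truncKernel β (σ * t) :=
  (integrable_truncKernel hβ).comp_mul_left' (ne_zero_of_eq_one_or hσ)

theorem integrable_indicator_L2 (u : Lp ℝ 2 μD) : Integrable ((Ioo (0 : ℝ) 1).indicator u) :=
  (integrable_indicator_iff measurableSet_Ioo).2 (integrable_of_L2 u)

theorem integrable_fracInt (hβ : β < 1) (hσ : σ = 1 ∨ σ = -1) (u : Lp ℝ 2 μD) :
    Integrable (fracInt β σ u) :=
  (integrable_indicator_L2 u).integrable_convolution (.mul ℝ ℝ)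
    (integrable_truncKernel_comp_mul hβ hσ)

theorem mul_sub_lt_one (hσ : σ = 1 ∨ σ = -1) {x y : ℝ} (hx : x ∈ Ioo (0 : ℝ) 1)
    (hy : y ∈ Ioo (0 : ℝ) 1) : σ * (y - x) < 1 := by
  rcases hσ with rfl | rfl <;> linarith [hx.1, hx.2, hy.1, hy.2]

/-- The damping tends to `1` and is dominated by it, jointly in both variables of the double
integral. -/
theorem tendsto_integral_fracKernel (hβ : β < 1) (hσ : σ = 1 ∨ σ = -1) (u : Lp ℝ 2 μD)
    {ψ : ℝ → ℝ} (hψ : Continuous ψ) (hψb : ∃ C, ∀ y, ‖ψ y‖ ≤ C)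
    (hψD : ∀ y ∉ Ioo (0 : ℝ) 1, ψ y = 0) :
    Tendsto (fun ε : ℝ => ∫ y, (∫ x, (Ioo (0 : ℝ) 1).indicator u x *
        fracKernel β ε (σ * (y - x))) * ψ y) (𝓝[>] 0)
      (𝓝 (∫ y, fracInt β σ u y * ψ y)) := by
  obtain ⟨C, hC⟩ := hψb
  let U := (Ioo (0 : ℝ) 1).indicator u
  -- `|p.1 - p.2|` agrees with `σ * (p.1 - p.2)` where the kernel does not vanish, and makes the
  -- exponential bounded by `1` everywhere.
  let G : ℝ → ℝ × ℝ → ℝ := fun ε p =>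
    U p.2 * truncKernel β (σ * (p.1 - p.2)) * (Real.exp (-(ε * |p.1 - p.2|)) * ψ p.1)
  have hG0 : Integrable (fun p : ℝ × ℝ => U p.2 * truncKernel β (σ * (p.1 - p.2)))
      (volume.prod volume) :=
    (integrable_indicator_L2 u).convolution_integrand (.mul ℝ ℝ)
      (integrable_truncKernel_comp_mul hβ hσ)
  have hb : ∀ ε, 0 ≤ ε → ∀ p : ℝ × ℝ, ‖Real.exp (-(ε * |p.1 - p.2|)) * ψ p.1‖ ≤ C := by
    intro ε hε p
    rw [norm_mul, Real.norm_of_nonneg (Real.exp_nonneg _)]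
    refine le_trans (mul_le_of_le_one_left (norm_nonneg _) ?_) (hC _)
    rw [Real.exp_le_one_iff]
    have := mul_nonneg hε (abs_nonneg (p.1 - p.2))
    linarith
  have hmeas : ∀ ε : ℝ, AEStronglyMeasurable
      (fun p : ℝ × ℝ => Real.exp (-(ε * |p.1 - p.2|)) * ψ p.1) (volume.prod volume) := by
    intro ε
    exact Continuous.aestronglyMeasurable (by fun_prop)
  have hG : ∀ ε, 0 ≤ ε → Integrable (G ε) (volume.prod volume) := fun ε hε =>
    hG0.mul_bdd (hmeas ε) (.of_forall (hb ε hε))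
  have heq : ∀ ε, 0 ≤ ε → ∫ p, G ε p ∂(volume.prod volume) =
      ∫ y, (∫ x, U x * fracKernel β ε (σ * (y - x))) * ψ y := by
    intro ε hε
    rw [integral_prod _ (hG ε hε)]
    refine integral_congr_ae (.of_forall fun y => ?_)
    simp only
    rw [← integral_mul_const]
    refine integral_congr_ae (.of_forall fun x => ?_)
    simp only [G, U]
    by_cases hy : y ∈ Ioo (0 : ℝ) 1
    · by_cases hx : x ∈ Ioo (0 : ℝ) 1
      · rw [fracKernel_eq_truncKernel_mul (mul_sub_lt_one hσ hx hy)]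
        by_cases hpos : 0 < σ * (y - x)
        · have : |y - x| = σ * (y - x) := by
            rcases hσ with rfl | rfl
            · rw [one_mul] at hpos ⊢; exact abs_of_pos hpos
            · rw [neg_one_mul] at hpos ⊢; exact abs_of_neg (by linarith)
          rw [this]; ring
        · have : truncKernel β (σ * (y - x)) = 0 := indicator_of_notMem (fun h => hpos h.1) _
          rw [this]; ring
      · simp [hx]
    · simp [hψD y hy]
  have hlim : ∫ y, fracInt β σ u y * ψ y = ∫ p, G 0 p ∂(volume.prod volume) := by
    rw [integral_prod _ (hG 0 le_rfl)]
    refine integral_congr_ae (.of_forall fun y => ?_)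
    simp only [fracInt, G, U, zero_mul, neg_zero, Real.exp_zero, one_mul]
    rw [integral_mul_const]
  rw [hlim]
  have hpos : ∀ᶠ ε : ℝ in 𝓝[>] 0, 0 < ε := self_mem_nhdsWithin
  refine Tendsto.congr' (hpos.mono fun ε hε => heq ε (le_of_lt hε)) ?_
  refine tendsto_integral_filter_of_dominated_convergence
    (fun p => ‖U p.2 * truncKernel β (σ * (p.1 - p.2))‖ * C) ?_ ?_ (hG0.norm.mul_const C) ?_
  · exact hpos.mono fun ε hε => (hG ε (le_of_lt hε)).1
  · filter_upwards [hpos] with ε hε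
    refine .of_forall fun p => ?_
    rw [norm_mul]
    exact mul_le_mul_of_nonneg_left (hb ε (le_of_lt hε) p) (norm_nonneg _)
  · refine .of_forall fun p => ?_
    have : Continuous fun ε : ℝ => G ε p := by simp only [G]; fun_prop
    exact (this.tendsto 0).mono_left nhdsWithin_le_nhds

theorem integral_fracInt_mul_deriv (hβ0 : 0 < β) (hβ : β < 1) (hσ : σ = 1 ∨ σ = -1) (u : HTilde β)
    {φ : ℝ → ℝ} (hφ : ContDiff ℝ ∞ φ) (hc : HasCompactSupport φ) (hsupp : tsupport φ ⊆ Ioo 0 1) :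
    ((∫ y, fracInt β σ u y * deriv φ y : ℝ) : ℂ) =
      -σ * ∫ x, fracDeriv hβ0 hσ u x * (φ x : ℂ) := by
  have hd : Continuous (deriv φ) := hφ.continuous_deriv (by simp)
  have h1 := tendsto_integral_fracKernel hβ hσ (HTilde.toL2 β u) hd
    (hc.deriv.exists_bound_of_continuous hd) (fun y hy => deriv_eq_zero_of_notMem hsupp hy)
  have h2 := tendsto_integral_convolution_mul hβ0 hβ hσ u (testSchwartz hφ hc)
  refine tendsto_nhds_unique ((Complex.continuous_ofReal.tendsto _).comp h1) (h2.congr fun ε => ?_)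
  simp only [Function.comp_apply]
  rw [← integral_complex_ofReal]
  refine integral_congr_ae (.of_forall fun y => ?_)
  simp only [lineDerivOp_testSchwartz]
  rw [Complex.ofReal_mul, ← integral_complex_ofReal]
  simp only [Complex.ofReal_mul]

theorem leftInt_eq_fracInt (f : ℝ → ℝ) {y : ℝ} (hy : y ∈ Ioo (0 : ℝ) 1) :
    leftInt (1 - β) f y = fracInt β 1 f y := by
  rw [leftInt, fracInt, intervalIntegral.integral_of_le hy.1.le, integral_Ioc_eq_integral_Ioo,
    ← integral_indicator measurableSet_Ioo, ← integral_const_mul]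
  refine integral_congr_ae (.of_forall fun x => ?_)
  simp only [one_mul, truncKernel, indicator, mem_Ioo]
  rcases hy with ⟨hy0, hy1⟩
  by_cases hx0 : 0 < x
  · by_cases hxy : x < y
    · rw [if_pos ⟨hx0, hxy⟩, if_pos ⟨hx0, hxy.trans hy1⟩,
        if_pos ⟨sub_pos.2 hxy, by linarith⟩, show 1 - β - 1 = -β by ring]
      ring
    · rw [if_neg (fun h => hxy h.2),
        if_neg (c := 0 < y - x ∧ y - x < 1) (fun h => hxy (sub_pos.1 h.1))]
      ring
  · rw [if_neg (fun h => hx0 h.1), if_neg (c := 0 < x ∧ x < 1) (fun h => hx0 h.1)]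
    ring

theorem rightInt_eq_fracInt (f : ℝ → ℝ) {y : ℝ} (hy : y ∈ Ioo (0 : ℝ) 1) :
    rightInt (1 - β) f y = fracInt β (-1) f y := by
  rw [rightInt, fracInt, intervalIntegral.integral_of_le hy.2.le, integral_Ioc_eq_integral_Ioo,
    ← integral_indicator measurableSet_Ioo, ← integral_const_mul]
  refine integral_congr_ae (.of_forall fun x => ?_)
  simp only [neg_one_mul, neg_sub, truncKernel, indicator, mem_Ioo]
  rcases hy with ⟨hy0, hy1⟩
  by_cases hx1 : x < 1
  · by_cases hxy : y < x
    · rw [if_pos ⟨hxy, hx1⟩, if_pos ⟨hy0.trans hxy, hx1⟩,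
        if_pos ⟨sub_pos.2 hxy, by linarith⟩, show 1 - β - 1 = -β by ring]
      ring
    · rw [if_neg (fun h => hxy h.1),
        if_neg (c := 0 < x - y ∧ x - y < 1) (fun h => hxy (sub_pos.1 h.1))]
      ring
  · rw [if_neg (fun h => hx1 h.2), if_neg (c := 0 < x ∧ x < 1) (fun h => hx1 h.2)]
    ring

theorem integrable_fracDeriv_mul (hβ0 : 0 < β) (hσ : σ = 1 ∨ σ = -1) (u : HTilde β)
    {φ : ℝ → ℝ} (hφ : ContDiff ℝ ∞ φ) (hc : HasCompactSupport φ) :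
    Integrable fun x => fracDeriv hβ0 hσ u x * (φ x : ℂ) := by
  have h1 : LocallyIntegrable (fracDeriv hβ0 hσ u) :=
    (Lp.memLp (fracDeriv hβ0 hσ u)).locallyIntegrable (by norm_num)
  have := h1.integrable_smul_left_of_hasCompactSupport hφ.continuous hc
  refine this.congr (.of_forall fun x => ?_)
  simp [mul_comm]

theorem integral_fracInt_mul_deriv_re (hβ0 : 0 < β) (hβ : β < 1) (hσ : σ = 1 ∨ σ = -1)
    (u : HTilde β) {φ : ℝ → ℝ} (hφ : ContDiff ℝ ∞ φ) (hc : HasCompactSupport φ)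
    (hsupp : tsupport φ ⊆ Ioo 0 1) :
    ∫ y, fracInt β σ u y * deriv φ y = -∫ x, σ * (fracDeriv hβ0 hσ u x).re * φ x := by
  have h := congrArg Complex.re (integral_fracInt_mul_deriv hβ0 hβ hσ u hφ hc hsupp)
  rw [Complex.ofReal_re, ← Complex.ofReal_neg, Complex.re_ofReal_mul] at h
  rw [h, neg_mul, neg_inj, ← Complex.reCLM_apply,
    ← Complex.reCLM.integral_comp_comm (integrable_fracDeriv_mul hβ0 hσ u hφ hc),
    ← integral_const_mul]
  refine integral_congr_ae (.of_forall fun x => ?_)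
  simp [mul_assoc]

/-- On `(0,1)`, `fracDeriv` is real, being a weak derivative of a real function. -/
theorem fracDeriv_im_ae_eq_zero (hβ0 : 0 < β) (hβ : β < 1) (hσ : σ = 1 ∨ σ = -1) (u : HTilde β) :
    ∀ᵐ x, x ∈ Ioo (0 : ℝ) 1 → (fracDeriv hβ0 hσ u x).im = 0 := by
  have hloc : LocallyIntegrable (fun x => (fracDeriv hβ0 hσ u x).im) :=
    ((Lp.memLp (fracDeriv hβ0 hσ u)).im).locallyIntegrable (by norm_num)
  refine isOpen_Ioo.ae_eq_zero_of_integral_contDiff_smul_eq_zero (hloc.locallyIntegrableOn _) ?_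
  intro φ hφ hc hsupp
  have h := congrArg Complex.im (integral_fracInt_mul_deriv hβ0 hβ hσ u hφ hc hsupp)
  rw [Complex.ofReal_im, ← Complex.ofReal_neg, Complex.im_ofReal_mul, eq_comm] at h
  have h1 := (mul_eq_zero.1 h).resolve_left (neg_ne_zero.2 (ne_zero_of_eq_one_or hσ))
  rw [← Complex.imCLM_apply,
    ← Complex.imCLM.integral_comp_comm (integrable_fracDeriv_mul hβ0 hσ u hφ hc)] at h1
  rw [← h1]
  refine integral_congr_ae (.of_forall fun x => ?_)
  simp [mul_comm]

theorem hasWeakDeriv_of_eq_fracInt (hβ0 : 0 < β) (hβ : β < 1) (hσ : σ = 1 ∨ σ = -1) (u : HTilde β)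
    {w : ℝ → ℝ} (hw : ∀ y ∈ Ioo (0 : ℝ) 1, w y = fracInt β σ u y) :
    HasWeakDeriv w fun x => σ * (fracDeriv hβ0 hσ u x).re where
  locallyIntegrable := by
    refine IntegrableOn.locallyIntegrableOn ?_
    exact ((integrable_fracInt hβ hσ (HTilde.toL2 β u)).integrableOn).congr_fun
      (fun y hy => (hw y hy).symm) measurableSet_Ioo
  locallyIntegrable_deriv := by
    have : LocallyIntegrable (fun x => σ * (fracDeriv hβ0 hσ u x).re) :=
      (((Lp.memLp (fracDeriv hβ0 hσ u)).re).const_mul σ).locallyIntegrable (by norm_num)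
    exact this.locallyIntegrableOn _
  integral_eq φ hφ hc hsupp := by
    rw [setIntegral_congr_fun (g := fun y => fracInt β σ u y * deriv φ y) measurableSet_Ioo
      (fun y hy => by simp only [hw y hy]),
      setIntegral_eq_integral_of_forall_compl_eq_zero
        (fun y hy => by rw [deriv_eq_zero_of_notMem hsupp hy, mul_zero]),
      setIntegral_eq_integral_of_forall_compl_eq_zero
        (fun y hy => by rw [eq_zero_of_notMem hsupp hy, mul_zero])]
    exact integral_fracInt_mul_deriv_re hβ0 hβ hσ u hφ hc hsupp

theorem HasWeakDeriv.ae_eq {w g g' : ℝ → ℝ} (h : HasWeakDeriv w g) (h' : HasWeakDeriv w g') :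
    g =ᵐ[μD] g' := by
  have key := isOpen_Ioo.ae_eq_zero_of_integral_contDiff_smul_eq_zero
    (h.locallyIntegrable_deriv.sub h'.locallyIntegrable_deriv) (μ := volume) fun φ hφ hc hsupp => by
      have hint : ∀ {g : ℝ → ℝ}, LocallyIntegrableOn g (Ioo 0 1) →
          IntegrableOn (fun x => g x * φ x) (Ioo 0 1) := by
        intro g hg
        have h1 : IntegrableOn g (tsupport φ) := hg.integrableOn_compact_subset hsupp hc
        have h2 : IntegrableOn (fun x => g x * φ x) (tsupport φ) :=
          h1.mul_continuousOn hφ.continuous.continuousOn hc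
        refine Integrable.integrableOn ?_
        refine (integrableOn_iff_integrable_of_support_subset fun x hx => ?_).1 h2
        exact subset_tsupport _ (right_ne_zero_of_mul hx)
      have e := (h.integral_eq φ hφ hc hsupp).symm.trans (h'.integral_eq φ hφ hc hsupp)
      rw [neg_inj, ← sub_eq_zero, ← integral_sub (hint h.locallyIntegrable_deriv)
        (hint h'.locallyIntegrable_deriv), setIntegral_eq_integral_of_forall_compl_eq_zero
        (fun y hy => by rw [eq_zero_of_notMem hsupp hy]; ring)] at e
      rw [← e]
      refine integral_congr_ae (.of_forall fun x => ?_)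
      simp only [Pi.sub_apply, smul_eq_mul]
      ring
  refine (ae_restrict_iff' measurableSet_Ioo).2 ?_
  filter_upwards [key] with x hx hD
  exact sub_eq_zero.1 (hx hD)

theorem HasWeakDeriv.weakDeriv_ae_eq {w g : ℝ → ℝ} (h : HasWeakDeriv w g) :
    weakDeriv w =ᵐ[μD] g := by
  have hex : ∃ g, HasWeakDeriv w g := ⟨g, h⟩
  rw [weakDeriv, dif_pos hex]
  exact hex.choose_spec.ae_eq h

theorem leftDeriv_ae_eq (hβ0 : 0 < β) (hβ : β < 1) (u : HTilde β) :
    leftDeriv β u =ᵐ[μD] fun x => (fracDeriv hβ0 (σ := 1) (Or.inl rfl) u x).re := by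
  have := (hasWeakDeriv_of_eq_fracInt hβ0 hβ (Or.inl rfl) u
    fun y hy => leftInt_eq_fracInt u hy).weakDeriv_ae_eq
  filter_upwards [this] with x hx
  exact hx.trans (one_mul _)

theorem rightDeriv_ae_eq (hβ0 : 0 < β) (hβ : β < 1) (v : HTilde β) :
    rightDeriv β v =ᵐ[μD] fun x => (fracDeriv hβ0 (σ := -1) (Or.inr rfl) v x).re := by
  have := (hasWeakDeriv_of_eq_fracInt hβ0 hβ (Or.inr rfl) v
    fun y hy => rightInt_eq_fracInt v hy).weakDeriv_ae_eq
  filter_upwards [this] with x hx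
  rw [rightDeriv, Pi.neg_apply, hx]
  ring

theorem inner_fourierInv (f g : Lp ℂ 2 (volume : Measure ℝ)) :
    inner ℝ (𝓕⁻ f : Lp ℂ 2 volume) (𝓕⁻ g) = inner ℝ f g := by
  let T : Lp ℂ 2 (volume : Measure ℝ) →ₗᵢ[ℝ] Lp ℂ 2 (volume : Measure ℝ) :=
    ⟨(Lp.fourierTransformₗᵢ ℝ ℂ).symm.toLinearEquiv.toLinearMap.restrictScalars ℝ,
      (Lp.fourierTransformₗᵢ ℝ ℂ).symm.norm_map⟩
  exact T.inner_map_map f g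

/-- Off `(0,1)` one of the two derivatives vanishes, so the integral may be taken over `ℝ`, where
Plancherel's theorem applies. -/
theorem integral_leftDeriv_mul_rightDeriv (hβ0 : 0 < β) (hβ : β < 1) (u v : HTilde β) :
    ∫ x in Ioo (0 : ℝ) 1, leftDeriv β u x * rightDeriv β v x =
      inner ℝ (fracDerivFourier hβ0 (σ := -1) (Or.inr rfl) v)
        (fracDerivFourier hβ0 (σ := 1) (Or.inl rfl) u) := by
  rw [← inner_fourierInv, L2.inner_def, ← integral_indicator measurableSet_Ioo]
  refine integral_congr_ae ?_
  have hne : ∀ᵐ x : ℝ, x ≠ 0 ∧ x ≠ 1 := by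
    have h0 : ∀ᵐ x : ℝ, x ≠ 0 := by simp [ae_iff]
    have h1 : ∀ᵐ x : ℝ, x ≠ 1 := by simp [ae_iff]
    exact h0.and h1
  filter_upwards [(ae_restrict_iff' measurableSet_Ioo).1 (leftDeriv_ae_eq hβ0 hβ u),
    (ae_restrict_iff' measurableSet_Ioo).1 (rightDeriv_ae_eq hβ0 hβ v),
    fracDeriv_im_ae_eq_zero hβ0 hβ (σ := 1) (Or.inl rfl) u,
    fracDeriv_ae_eq_zero_of_disjoint hβ0 hβ (σ := 1) (Or.inl rfl) u (isOpen_Iio (a := 0))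
      (fun y hy x hx => by rw [mem_Iio] at hy; linarith [hx.1]),
    fracDeriv_ae_eq_zero_of_disjoint hβ0 hβ (σ := -1) (Or.inr rfl) v (isOpen_Ioi (a := 1))
      (fun y hy x hx => by rw [mem_Ioi] at hy; linarith [hx.2]), hne]
    with x hl hr him h0 h1 hx
  change _ = inner ℝ (fracDeriv hβ0 (σ := -1) (Or.inr rfl) v x)
    (fracDeriv hβ0 (σ := 1) (Or.inl rfl) u x)
  by_cases hD : x ∈ Ioo (0 : ℝ) 1
  · rw [indicator_of_mem hD, hl hD, hr hD, Complex.inner, Complex.mul_re, Complex.conj_re,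
      him hD]
    ring
  · rw [indicator_of_notMem hD]
    rcases lt_or_gt_of_ne hx.1 with h | h
    · rw [h0 h, inner_zero_right]
    · have : 1 < x := by
        by_contra h'
        exact hD ⟨h, lt_of_le_of_ne (not_lt.1 h') hx.2⟩
      rw [h1 this, inner_zero_left]

/-! ### The bilinear forms -/

theorem conj_fracSymbol_neg_one (ξ : ℝ) :
    (starRingEnd ℂ) (fracSymbol β (-1) ξ) = fracSymbol β 1 ξ := by
  rw [fracSymbol, fracSymbol, ← Complex.conj_conj (β : ℂ), ← Complex.conj_cpow, Complex.conj_ofReal]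
  · have h2 : (starRingEnd ℂ) 2 = 2 := Complex.conj_ofReal 2
    congr 1
    · simp [h2]
    · exact (Complex.conj_ofReal β).symm
  · exact arg_two_pi_I_mul_ne_pi ξ

/-- `(2πiξ)^β` has argument `±πβ/2`. -/
theorem fracSymbol_sq_re (hβ0 : 0 < β) (ξ : ℝ) :
    (fracSymbol β 1 ξ * fracSymbol β 1 ξ).re = Real.cos (Real.pi * β) * ‖fracSymbol β 1 ξ‖ ^ 2 := by
  by_cases hξ : ξ = 0
  · have : fracSymbol β 1 ξ = 0 := by
      rw [fracSymbol, hξ]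
      simp [hβ0.ne']
    simp [this]
  have hz : (2 * Real.pi * Complex.I * ((1 : ℝ) * ξ) : ℂ) ≠ 0 := by simp [hξ, Real.pi_ne_zero]
  have harg : |(2 * Real.pi * Complex.I * ((1 : ℝ) * ξ) : ℂ).arg| = Real.pi / 2 := by
    refine le_antisymm (Complex.abs_arg_le_pi_div_two_iff.2 (by simp)) (not_lt.1 fun h => ?_)
    rcases Complex.abs_arg_lt_pi_div_two_iff.1 h with h | h
    · simp at h
    · exact hz h
  rw [norm_fracSymbol (Or.inl rfl), fracSymbol, ← Complex.cpow_add _ _ hz, ← Complex.ofReal_add,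
    Complex.cpow_ofReal_re, norm_two_pi_I_mul (Or.inl rfl), mul_comm, sq,
    ← Real.rpow_add (by have := Real.pi_pos; positivity), ← Real.cos_abs, abs_mul, harg,
    abs_of_pos (by linarith : 0 < β + β)]
  congr 2
  ring

theorem inner_fracDerivFourier_self (hβ0 : 0 < β) (u : HTilde β) :
    inner ℝ (fracDerivFourier hβ0 (σ := -1) (Or.inr rfl) u)
      (fracDerivFourier hβ0 (σ := 1) (Or.inl rfl) u) =
    Real.cos (Real.pi * β) * ‖fracDerivFourier hβ0 (σ := 1) (Or.inl rfl) u‖ ^ 2 := by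
  rw [norm_sq_eq_integral, L2.inner_def, ← integral_const_mul]
  refine integral_congr_ae ?_
  filter_upwards [fracDerivFourier_ae_eq hβ0 (σ := 1) (Or.inl rfl) u,
    fracDerivFourier_ae_eq hβ0 (σ := -1) (Or.inr rfl) u] with ξ h1 h2
  rw [h1, h2, Complex.inner, map_mul, conj_fracSymbol_neg_one, norm_mul, mul_pow,
    ← mul_assoc (Real.cos _), ← fracSymbol_sq_re hβ0, ← Complex.normSq_eq_norm_sq,
    ← Complex.re_mul_ofReal, ← Complex.mul_conj]
  congr 1
  ring

theorem norm_sq_le_fracDerivFourier (hβ0 : 0 < β) (hβ : β < 1) (u : HTilde β) :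
    (2 * Real.pi) ^ (2 * β) * ‖u‖ ^ 2 ≤
      ‖fracDerivFourier hβ0 (σ := 1) (Or.inl rfl) u‖ ^ 2 +
        (2 * Real.pi) ^ (2 * β) * ‖HTilde.toL2 β u‖ ^ 2 := by
  have hint := integrable_norm_sq (fracDerivFourier hβ0 (σ := 1) (Or.inl rfl) u)
  have hint' := (integrable_zeroExtFourier_sq (HTilde.toL2 β u)).const_mul
    ((2 * Real.pi) ^ (2 * β))
  have hpi := Real.pi_pos
  rw [HTilde.norm_sq_eq_integral, norm_sq_eq_integral, norm_sq_eq_integral_zeroExtFourier,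
    ← integral_const_mul, ← integral_const_mul, ← integral_add hint hint']
  refine integral_mono_ae ((HTilde.integrable_weight_mul u).const_mul _) (hint.add hint') ?_
  filter_upwards [fracDerivFourier_ae_eq hβ0 (σ := 1) (Or.inl rfl) u] with ξ h
  rw [h, norm_mul, mul_pow, norm_fracSymbol (Or.inl rfl), ← Real.rpow_mul_natCast (by positivity),
    Real.mul_rpow (by positivity) (abs_nonneg _)]
  have h1 : (1 + ξ ^ 2) ^ β ≤ 1 + |ξ| ^ (2 * β) := by
    have := Real.rpow_add_le_add_rpow zero_le_one (sq_nonneg ξ) hβ0.le hβ.le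
    have h3 : (ξ ^ 2) ^ β = |ξ| ^ (2 * β) := by
      rw [← sq_abs, ← Real.rpow_natCast_mul (abs_nonneg _)]
      norm_cast
    rwa [Real.one_rpow, h3] at this
  have h2 : β * ((2 : ℕ) : ℝ) = 2 * β := by push_cast; ring
  rw [h2]
  calc _ ≤ (2 * Real.pi) ^ (2 * β) * ((1 + |ξ| ^ (2 * β)) *
        ‖zeroExtFourier (HTilde.toL2 β u) ξ‖ ^ 2) := by gcongr
    _ = _ := by ring

theorem inner_L2_eq (f g : Lp ℝ 2 μD) : inner ℝ f g = ∫ x in Ioo (0 : ℝ) 1, f x * g x := by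
  rw [L2.inner_def]
  refine integral_congr_ae (.of_forall fun x => ?_)
  simp [mul_comm]

/-- Multiplication by the bounded function `q` on `L²(0,1)`. -/
def mulL {q : ℝ → ℝ} (hq : MemLp q ⊤ μD) : Lp ℝ 2 μD →L[ℝ] Lp ℝ 2 μD :=
  (ContinuousLinearMap.mul ℝ ℝ).holderL μD ⊤ 2 2 (hq.toLp q)

theorem mulL_ae_eq {q : ℝ → ℝ} (hq : MemLp q ⊤ μD) (f : Lp ℝ 2 μD) :
    mulL hq f =ᵐ[μD] fun x => q x * f x := by
  filter_upwards [ContinuousLinearMap.coeFn_holder (r := 2) (ContinuousLinearMap.mul ℝ ℝ)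
    (hq.toLp q) f, hq.coeFn_toLp] with x h1 h2
  refine h1.trans ?_
  rw [h2]
  rfl

/-- The kernel of `f ↦ ₀I_x^α f (1)`; it is bounded since `α > 1`. -/
theorem memLp_leftIntKernel {α : ℝ} (hα : 1 < α) :
    MemLp (fun t : ℝ => 1 / Real.Gamma α * (1 - t) ^ (α - 1)) 2 μD := by
  refine MemLp.const_mul (MemLp.of_bound (C := 1) ?_ ?_) _
  · exact Measurable.aestronglyMeasurable (by fun_prop)
  · filter_upwards [ae_restrict_mem measurableSet_Ioo] with t ht
    have h0 : 0 ≤ 1 - t := by linarith [ht.2]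
    rw [Real.norm_of_nonneg (by positivity)]
    exact Real.rpow_le_one h0 (by linarith [ht.1]) (by linarith)

theorem memLp_Q {α : ℝ} (hα : α ∈ Ioo (1 : ℝ) 2) {q : ℝ → ℝ} (hq : MemLp q ⊤ μD) :
    MemLp (Q α q) 2 μD := by
  have h1 : MemLp (c₁ α) ⊤ μD := by
    refine MemLp.const_mul (memLp_top_of_bound (C := 1)
      (Measurable.aestronglyMeasurable (by fun_prop)) ?_) _
    filter_upwards [ae_restrict_mem measurableSet_Ioo] with t ht
    have h0 : 0 ≤ t := ht.1.le
    rw [Real.norm_of_nonneg (by positivity)]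
    exact Real.rpow_le_one h0 ht.2.le (by linarith [hα.2])
  have h2 : MemLp (singFun α) ⊤ μD := by
    refine memLp_top_of_bound (C := 1) (Measurable.aestronglyMeasurable ?_) ?_
    · unfold singFun; fun_prop
    · filter_upwards [ae_restrict_mem measurableSet_Ioo] with t ht
      have h0 : 0 ≤ t := ht.1.le
      have h3 : t ^ (α - 1) ≤ 1 := Real.rpow_le_one h0 ht.2.le (by linarith [hα.1])
      have h4 : 0 ≤ t ^ (α - 1) := by positivity
      rw [singFun, Real.norm_eq_abs, abs_le]
      constructor <;> nlinarith [ht.1, ht.2]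
  have h3 : MemLp (Q α q) ⊤ μD := by
    refine (h1.const_mul (c₀ α q)).sub ?_
    exact h2.mul' (hq.const_mul (c₀ α q))
  exact h3.mono_exponent le_top

theorem leftInt_mul_one_eq {α : ℝ} (hα : 1 < α) {q : ℝ → ℝ} (hq : MemLp q ⊤ μD) (f : Lp ℝ 2 μD) :
    leftInt α (fun t => q t * f t) 1 = inner ℝ ((memLp_leftIntKernel hα).toLp _) (mulL hq f) := by
  rw [inner_L2_eq, leftInt, intervalIntegral.integral_of_le zero_le_one,
    integral_Ioc_eq_integral_Ioo, ← integral_const_mul]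
  refine integral_congr_ae ?_
  filter_upwards [mulL_ae_eq hq f, (memLp_leftIntKernel hα).coeFn_toLp] with t h1 h2
  rw [h1, h2]
  ring

/-- The form `b`, which is bounded already on `L²(0,1)`. -/
def bilinB {α : ℝ} (hα : α ∈ Ioo (1 : ℝ) 2) {q : ℝ → ℝ} (hq : MemLp q ⊤ μD) :
    Lp ℝ 2 μD →L[ℝ] Lp ℝ 2 μD →L[ℝ] ℝ :=
  (innerBilin _) ∘L mulL hq +
    ((innerBilin _ ((memLp_leftIntKernel hα.1).toLp _)) ∘L mulL hq).smulRight
      (innerBilin _ ((memLp_Q hα hq).toLp _))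

theorem formB_eq {α : ℝ} (hα : α ∈ Ioo (1 : ℝ) 2) {q : ℝ → ℝ} (hq : MemLp q ⊤ μD)
    (u v : HTilde (α / 2)) :
    formB α q u v = bilinB hα hq (HTilde.toL2 _ u) (HTilde.toL2 _ v) := by
  have h1 : ∫ x in Ioo (0 : ℝ) 1, q x * u x * v x =
      inner ℝ (mulL hq (HTilde.toL2 _ u)) (HTilde.toL2 _ v) := by
    rw [inner_L2_eq]
    refine integral_congr_ae ?_
    filter_upwards [mulL_ae_eq hq (HTilde.toL2 _ u)] with x hx
    rw [hx]
  have h2 : ∫ x in Ioo (0 : ℝ) 1, Q α q x * v x =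
      inner ℝ ((memLp_Q hα hq).toLp _) (HTilde.toL2 _ v) := by
    rw [inner_L2_eq]
    refine integral_congr_ae ?_
    filter_upwards [(memLp_Q hα hq).coeFn_toLp] with x hx
    rw [hx]
  rw [formB, h1, h2, leftInt_mul_one_eq hα.1 hq]
  simp [bilinB]

/-- The form `A`, in terms of the Fourier side of the two fractional derivatives. -/
def bilinA (hβ0 : 0 < β) : HTilde β →L[ℝ] HTilde β →L[ℝ] ℝ :=
  -(innerBilin (Lp ℂ 2 (volume : Measure ℝ))).bilinearComp
    (fracDerivFourier hβ0 (σ := 1) (Or.inl rfl)) (fracDerivFourier hβ0 (σ := -1) (Or.inr rfl))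

theorem formA_eq {α : ℝ} (hβ0 : 0 < α / 2) (hβ : α / 2 < 1) (u v : HTilde (α / 2)) :
    formA α u v = bilinA hβ0 u v := by
  rw [formA, integral_leftDeriv_mul_rightDeriv hβ0 hβ, real_inner_comm]
  simp [bilinA]

/-- For `1/2 < β < 1` the factor `-cos(πβ)` is positive, and this is Gårding's inequality: as the
real part of `(2πiξ)^(2β)` is `(2π|ξ|)^(2β) cos(πβ)`, the form controls the `H^β` norm up to the
`L²` norm. -/
theorem garding_bilinA (hβ0 : 0 < β) (hβ : β < 1) (hcos : Real.cos (Real.pi * β) ≤ 0)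
    (u : HTilde β) :
    -Real.cos (Real.pi * β) * (2 * Real.pi) ^ (2 * β) * ‖u‖ ^ 2 ≤ bilinA hβ0 u u +
      -Real.cos (Real.pi * β) * (2 * Real.pi) ^ (2 * β) * ‖HTilde.toL2 β u‖ ^ 2 := by
  have h := mul_le_mul_of_nonneg_left (norm_sq_le_fracDerivFourier hβ0 hβ u) (neg_nonneg.2 hcos)
  have : bilinA hβ0 u u = -(Real.cos (Real.pi * β) *
      ‖fracDerivFourier hβ0 (σ := 1) (Or.inl rfl) u‖ ^ 2) := by
    rw [← inner_fracDerivFourier_self, real_inner_comm]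
    simp [bilinA]
  rw [this]
  linarith

end

end FracBVP

theorem theorem3p1 (α : ℝ) (hα : α ∈ Set.Ioo (1 : ℝ) 2)
    (q : ℝ → ℝ) (hq : MeasureTheory.MemLp q ⊤ FracBVP.μD)
    (hc : FracBVP.leftInt α (fun t => q t * FracBVP.singFun α t) 1 ≠ -1)
    (hA : FracBVP.UniquenessAssumption α q)
    (F : StrongDual ℝ (FracBVP.HTilde (α / 2))) :
    ∃! u : FracBVP.HTilde (α / 2), ∀ v : FracBVP.HTilde (α / 2),
      FracBVP.formAr α q u v = F v := by
  have hβ0 : 0 < α / 2 := by linarith [hα.1]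
  have hβ1 : α / 2 < 1 := by linarith [hα.2]
  have hcos : Real.cos (Real.pi * (α / 2)) < 0 := by
    refine Real.cos_neg_of_pi_div_two_lt_of_lt ?_ ?_ <;> nlinarith [Real.pi_pos, hα.1, hα.2]
  have hform : ∀ u v, FracBVP.formAr α q u v = FracBVP.bilinA hβ0 u v +
      FracBVP.bilinB hα hq (FracBVP.HTilde.toL2L hβ0.le u) (FracBVP.HTilde.toL2L hβ0.le v) :=
    fun u v => by
      rw [FracBVP.formAr, FracBVP.formA_eq hβ0 hβ1, FracBVP.formB_eq hα hq]
      rfl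
  have := FracBVP.HTilde.completeSpace hβ0.le
  simp_rw [hform]
  refine FracBVP.existsUnique_of_garding _ (FracBVP.HTilde.isCompactOperator_toL2L hβ0) _ _
    (c := -Real.cos (Real.pi * (α / 2)) * (2 * Real.pi) ^ (2 * (α / 2)))
    (mul_pos (neg_pos.2 hcos) (Real.rpow_pos_of_pos Real.two_pi_pos _))
    (FracBVP.garding_bilinA hβ0 hβ1 hcos.le) (fun u hu => hA.a u fun v => ?_) F
  rw [hform]
  exact hu v
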